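/- Let $\psi_j(x)=(\sqrt{\pi}\,2^j j!)^{-1/2}H_j(x)e^{-x^2/2}$, $j\in\mathbb N=\{0,1,2,\dots\}$, be the Fock basis of $L^2(\mathbb R)$, $H_j(x)=(-1)^je^{x^2}\frac{d^j}{dx^j}e^{-x^2}$. Let $\rho$ be a pure Fock state: its density matrix in this basis satisfies $\rho_{j_0,j_0}=1$ for some $j_0\in\mathbb N$ and $\rho_{j,k}=0$ for all $(j,k)\neq(j_0,j_0)$. Let $W_\rho$ be its Wigner function, i.e. the function on $\mathbb R^2$ with Fourier transform $\iint e^{i(uq+vp)}W_\rho(q,p)\,dq\,dp=\mathrm{Tr}(\rho\, e^{iu\mathbf Q+iv\mathbf P})$, where $\mathbf Q$ is multiplication by $x$ and $\mathbf P=-i\,d/dx$, and let $p_\rho(x|\phi)=\int_{\mathbb R} W_\rho(x\cos\phi-t\sin\phi,\,x\sin\phi+t\cos\phi)\,dt$ be its Radon transform. Let $\eta\in(1/2,1]$ and let $(Y_1,\Phi_1),\dots,(Y_n,\Phi_n)$ be i.i.d. with the law of $\big(\sqrt{\eta}\,X+\sqrt{(1-\eta)/2}\;\xi,\ \Phi\big)$,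 where $(X,\Phi)$ has density $\frac1\pi p_\rho(x|\phi)$ with respect to Lebesgue measure on $\mathbb R\times[0,\pi]$ and $\xi$ is standard Gaussian and independent of $(X,\Phi)$. Put $\gamma=\frac{1-\eta}{4\eta}$. For $j\ge k$ let $f^\eta_{j,k}=f^\eta_{k,j}$ be the function with Fourier transform $$\int_{\mathbb R} f^\eta_{j,k}(x)e^{-itx}\,dx=\pi(-i)^{j-k}\sqrt{\tfrac{2^{k-j}k!}{j!}}\;|t|\,t^{j-k}e^{-t^2/4}L_k^{j-k}(t^2/2)\;e^{\gamma t^2},$$ where $L_n^{\alpha}(x)=(n!)^{-1}e^xx^{-\alpha}\frac{d^n}{dx^n}(e^{-x}x^{n+\alpha})$ is the Laguerre polynomial, so that for $\eta=1$ it is the usual pattern function $f_{j,k}$. Write $\|f\|_\infty=\sup_{x\in\mathbb R}|f(x)|$. Let $\varepsilon\in(0,1)$, $B_0>0$, $r_0\in(0,2)$ and $$N=N(n)=\Big\lfloor\Big(\frac{\log n}{2B_0}\Big)^{2/r_0}\Big\rfloor .$$ Define $\hat\rho^\eta_{j,k}=\frac1n\sum_{\ell=1}^n f^\eta_{j,k}(Y_\ell/\sqrt\eta)\,e^{-i(j-k)\Phi_\ell}$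 if $j+k\le N-1$ and $\hat\rho^\eta_{j,k}=0$ otherwise, and, with the convention $0/0=0$, $$\tilde\rho^\eta_{j,k}=\frac{\hat\rho^\eta_{j,k}}{|\hat\rho^\eta_{j,k}|}\big(|\hat\rho^\eta_{j,k}|-t_{j,k}\big)_+,\qquad t_{j,k}=2\|f^\eta_{j,k}\|_\infty\sqrt{\frac{\log\big(2N(N+1)/\varepsilon\big)}{n}} .$$ Then, as soon as $N>\max(2j_0,2)$, with probability at least $1-\varepsilon$, $$\|\tilde\rho^\eta-\rho\|_2^2=\sum_{j,k\ge0}|\tilde\rho^\eta_{j,k}-\rho_{j,k}|^2<\frac{64}{n\,r_0}\,\|f^\eta_{j_0,j_0}\|_\infty^2\,\log\Big(\frac{2\log n}{B_0\,\varepsilon}\Big).$$ -/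

import Mathlib

open MeasureTheory ProbabilityTheory

noncomputable section

namespace QHT

/-! ### The Fock basis and states -/

/-- The `j`-th (physicists') Hermite function
`H_j(x) = (-1)^j e^{x^2} (d/dx)^j e^{-x^2}`. -/
def hermiteH (j : ℕ) (x : ℝ) : ℝ :=
  (-1) ^ j * Real.exp (x ^ 2) * iteratedDeriv j (fun y : ℝ => Real.exp (-y ^ 2)) x

/-- The Fock basis function
`ψ_j(x) = (√π 2^j j!)^{-1/2} H_j(x) e^{-x^2/2}` of `L²(ℝ)`. -/
def fockBasis (j : ℕ) (x : ℝ) : ℝ :=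
  1 / √(√Real.pi * 2 ^ j * (j.factorial : ℝ)) * hermiteH j x * Real.exp (-x ^ 2 / 2)

/-- The density matrix, in the Fock basis, of the pure Fock state with index `j₀`: the entry
`(j₀, j₀)` is `1` and all the other entries are `0`. -/
def fockState (j₀ : ℕ) : ℕ → ℕ → ℂ :=
  fun j k => if j = j₀ ∧ k = j₀ then 1 else 0

/-! ### Wigner function and law of the measurements -/

/-- The unitary operator `exp(iuQ + ivP)` on `L²(ℝ)` in the Schrödinger representation
(`Q` is multiplication by `x`, `P = -i d/dx`):
`(exp(iuQ + ivP) ψ)(x) = e^{iuv/2 + iux} ψ(x + v)`. -/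
def weyl (u v : ℝ) (ψ : ℝ → ℂ) (x : ℝ) : ℂ :=
  Complex.exp (Complex.I * ((u * v / 2 + u * x : ℝ) : ℂ)) * ψ (x + v)

/-- The matrix entry `⟨ψ_j, exp(iuQ + ivP) ψ_k⟩` in the Fock basis. -/
def weylEntry (u v : ℝ) (j k : ℕ) : ℂ :=
  ∫ x : ℝ, (fockBasis j x : ℂ) * weyl u v (fun y => (fockBasis k y : ℂ)) x

/-- `Tr(ρ exp(iuQ + ivP))`, the Fourier transform of the Wigner function of `ρ` at `(u, v)`. -/
def wignerFourier (ρ : ℕ → ℕ → ℂ) (u v : ℝ) : ℂ :=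
  ∑' j : ℕ, ∑' k : ℕ, ρ j k * weylEntry u v k j

/-- The Wigner function `W_ρ`: the (real) function whose Fourier transform
`∬ e^{i(uq + vp)} W_ρ(q, p) dq dp` is `Tr(ρ exp(iuQ + ivP))`, given by Fourier inversion. -/
def wigner (ρ : ℕ → ℕ → ℂ) (q p : ℝ) : ℝ :=
  (1 / ((2 * Real.pi : ℝ) : ℂ) ^ 2 *
    ∫ w : ℝ × ℝ, Complex.exp (-(Complex.I * ((w.1 * q + w.2 * p : ℝ) : ℂ))) *
      wignerFourier ρ w.1 w.2).re

/-- The conditional density `p_ρ(x|φ)`: the Radon transform of the Wigner function. -/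
def quadratureDensity (ρ : ℕ → ℕ → ℂ) (x φ : ℝ) : ℝ :=
  ∫ t : ℝ, wigner ρ (x * Real.cos φ - t * Real.sin φ) (x * Real.sin φ + t * Real.cos φ)

/-- The law of an ideal measurement `(X, Φ)`: it has density `p_ρ(x|φ)/π` with respect to the
Lebesgue measure on `ℝ × [0, π]`. -/
def idealLaw (ρ : ℕ → ℕ → ℂ) : Measure (ℝ × ℝ) :=
  ((volume : Measure (ℝ × ℝ)).restrict (Set.univ ×ˢ Set.Icc 0 Real.pi)).withDensity
    (fun z => ENNReal.ofReal (quadratureDensity ρ z.1 z.2 / Real.pi))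

/-- The law of a noisy measurement `(Y, Φ)` with detection efficiency `η`, where
`Y = √η X + √((1-η)/2) ξ`, the pair `(X, Φ)` follows the ideal law and `ξ` is standard Gaussian,
independent of `(X, Φ)`. -/
def noisyLaw (η : ℝ) (ρ : ℕ → ℕ → ℂ) : Measure (ℝ × ℝ) :=
  ((idealLaw ρ).prod (gaussianReal 0 1)).map
    (fun z : (ℝ × ℝ) × ℝ => (√η * z.1.1 + √((1 - η) / 2) * z.2, z.1.2))

/-! ### Pattern functions -/

/-- The Laguerre polynomial of degree `n` and order `a`,
`L_n^a(x) = ∑_{i ≤ n} (-1)^i binom(n + a, n - i) x^i / i!`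
`= (n!)^{-1} e^x x^{-a} (d/dx)^n (e^{-x} x^{n+a})`. -/
def laguerre (n a : ℕ) (x : ℝ) : ℝ :=
  ∑ i ∈ Finset.range (n + 1),
    (-1) ^ i * ((n + a).choose (n - i) : ℝ) * x ^ i / (i.factorial : ℝ)

/-- The Fourier transform of the pattern function `f_{j,k} = f_{k,j}`: for `j ≥ k` it is
`π (-i)^{j-k} √(2^{k-j} k!/j!) |t| t^{j-k} e^{-t²/4} L_k^{j-k}(t²/2)`. -/
def patternFourier (j k : ℕ) (t : ℝ) : ℂ :=
  (Real.pi : ℂ) * (-Complex.I) ^ (max j k - min j k) *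
    ((√(((min j k).factorial : ℝ) / (2 ^ (max j k - min j k) * ((max j k).factorial : ℝ))) *
      |t| * t ^ (max j k - min j k) * Real.exp (-t ^ 2 / 4) *
      laguerre (min j k) (max j k - min j k) (t ^ 2 / 2) : ℝ) : ℂ)

/-- `γ = (1 - η) / (4η)`. -/
def gam (η : ℝ) : ℝ := (1 - η) / (4 * η)

/-- The adapted pattern function `f^η_{j,k}`, with Fourier transform
`∫ f^η_{j,k}(x) e^{-itx} dx` equal to that of `f_{j,k}` times `e^{γt²}`. It takes real values,
which are regarded here as complex numbers. For `η = 1` it is `f_{j,k}`. -/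
def patternFn (η : ℝ) (j k : ℕ) (x : ℝ) : ℂ :=
  1 / ((2 * Real.pi : ℝ) : ℂ) *
    ∫ t : ℝ, Complex.exp (Complex.I * ((t * x : ℝ) : ℂ)) *
      (patternFourier j k t * ((Real.exp (gam η * t ^ 2) : ℝ) : ℂ))

/-- The supremum norm of a function on `ℝ`. -/
def supNorm (f : ℝ → ℂ) : ℝ := ⨆ x : ℝ, ‖f x‖

/-! ### The estimator -/

/-- `G_{j,k}(x, φ) = f^η_{j,k}(x) e^{-i(j-k)φ}`. -/
def kernelG (η : ℝ) (j k : ℕ) (x φ : ℝ) : ℂ :=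
  patternFn η j k x * Complex.exp (-(Complex.I * ((((j : ℝ) - (k : ℝ)) * φ : ℝ) : ℂ)))

/-- The initial estimator: empirical means for `0 ≤ j + k ≤ N - 1`, and `0` otherwise. -/
def rhoHat {n : ℕ} (η : ℝ) (N : ℕ) (y φ : Fin n → ℝ) (j k : ℕ) : ℂ :=
  if j + k < N then 1 / (n : ℂ) * ∑ l : Fin n, kernelG η j k (y l / √η) (φ l) else 0

/-- The threshold `t_{j,k} = 2 ‖f^η_{j,k}‖_∞ √(log(2N(N+1)/ε)/n)`. -/
def threshold (n : ℕ) (η : ℝ) (N : ℕ) (ε : ℝ) (j k : ℕ) : ℝ :=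
  2 * supNorm (patternFn η j k) * √(Real.log (2 * (N : ℝ) * ((N : ℝ) + 1) / ε) / (n : ℝ))

/-- The final estimator, obtained by soft thresholding (with `0/0 = 0`). -/
def rhoTilde {n : ℕ} (η : ℝ) (N : ℕ) (ε : ℝ) (y φ : Fin n → ℝ) (j k : ℕ) : ℂ :=
  rhoHat η N y φ j k / ((‖rhoHat η N y φ j k‖ : ℝ) : ℂ) *
    ((max (‖rhoHat η N y φ j k‖ - threshold n η N ε j k) 0 : ℝ) : ℂ)

/-- The `ℓ₂`-norm of an infinite matrix. -/
def l2Norm (ν : ℕ → ℕ → ℂ) : ℝ := √(∑' p : ℕ × ℕ, ‖ν p.1 p.2‖ ^ 2)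

/-- The tuning parameter `N(n) = ⌊(log n / (2B₀))^{2/r₀}⌋`. -/
def tuningN (B₀ r₀ : ℝ) (n : ℕ) : ℕ := ⌊(Real.log n / (2 * B₀)) ^ (2 / r₀)⌋₊

end QHT

end

/-! The argument has three ingredients.

Unbiasedness. The Wigner function of a Fock state is radial, so its quadratures have density `ψ_n ^
2` at every phase and are independent of the phase. Their characteristic function is `e^{-t²/4}
L_n(t²/2)`; detector noise multiplies it by `e^{-γt²}`, exactly what the factor `e^{γt²}` in the
pattern function undoes. The mean of the kernel is thus a phase average times the pairing of
`patternFourier j k` with `e^{-t²/4} L_n(t²/2)`. On the diagonal the pairing is Laguerre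
orthonormality. Off it, the phase average vanishes when `j - k` is even, and the integrand is odd in
`t` when `j - k` is odd. This is `integral_kernelG_noisyLaw_eq_fockState`; the explicit transforms
all come from one Gaussian integral of shifted Hermite polynomials,
`integral_hermitePoly_mul_hermitePoly`.

Concentration. Hoeffding's inequality for real and imaginary parts, with a union bound over the
`N(N+1)/2` entries, puts every empirical entry within its threshold of the truth with probability at
least `1 - ε`.

Thresholding. On that event every entry whose true value is zero is set to zero, and the entry `(j₀,
j₀)` is off by at most twice its threshold. The definition of `N` then turns `log(2N(N+1)/ε)` into
the stated logarithm (`log_le_of_lt_tuningN`). -/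

noncomputable section

namespace QHT

/-! ### Algebra of Hermite polynomials -/

open Polynomial in
/-- The operator `q ↦ 2 X q - q'` on polynomials, which raises the degree of a Hermite polynomial. -/
def raising (R : Type*) [CommRing R] : Module.End R R[X] :=
  LinearMap.mulLeft R (2 * X) - derivative

open Polynomial in
/-- The physicists' Hermite polynomials. -/
def hermitePoly (R : Type*) [CommRing R] (n : ℕ) : R[X] := (raising R ^ n) 1

section Hermite

open Polynomial

variable {R : Type*} [CommRing R]

lemma hermitePoly_zero : hermitePoly R 0 = 1 := by simp [hermitePoly]

lemma hermitePoly_succ (n : ℕ) :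
    hermitePoly R (n + 1) = 2 * X * hermitePoly R n - derivative (hermitePoly R n) := by
  rw [hermitePoly, pow_succ', Module.End.mul_apply]
  rfl

lemma derivative_hermitePoly_succ (n : ℕ) :
    derivative (hermitePoly R (n + 1)) = 2 * (n + 1 : R[X]) * hermitePoly R n := by
  induction n with
  | zero => simp [hermitePoly_succ, hermitePoly_zero]
  | succ n ih =>
    rw [hermitePoly_succ (n + 1)]
    simp only [derivative_sub, derivative_mul, ih]
    simp only [derivative_X, derivative_ofNat, derivative_add, derivative_natCast, derivative_one]
    rw [hermitePoly_succ n]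
    push_cast
    ring

lemma iterate_derivative_hermitePoly_add (k m : ℕ) :
    derivative^[k] (hermitePoly R (m + k)) =
      (2 ^ k * (m + k).descFactorial k : R[X]) * hermitePoly R m := by
  induction k with
  | zero => simp
  | succ k ih =>
    have h1 : derivative^[k] (((2 * (m + k + 1 : ℕ) : ℕ) : R[X]) * hermitePoly R (m + k)) =
        ((2 * (m + k + 1 : ℕ) : ℕ) : R[X]) * derivative^[k] (hermitePoly R (m + k)) := by
      rw [iterate_derivative_natCast_mul]
    rw [Function.iterate_succ_apply, ← add_assoc, derivative_hermitePoly_succ]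
    have h2 : (2 * (((m + k : ℕ) : R[X]) + 1)) = ((2 * (m + k + 1 : ℕ) : ℕ) : R[X]) := by
      push_cast; ring
    rw [h2, h1, ih, Nat.succ_descFactorial_succ]
    push_cast
    ring

lemma map_hermitePoly {S : Type*} [CommRing S] (f : R →+* S) (n : ℕ) :
    (hermitePoly R n).map f = hermitePoly S n := by
  induction n with
  | zero => simp [hermitePoly_zero]
  | succ n ih => simp [hermitePoly_succ, ← derivative_map, ih]

lemma hermitePoly_comp_neg_X (n : ℕ) :
    (hermitePoly R n).comp (-X) = (-1) ^ n * hermitePoly R n := by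
  induction n with
  | zero => simp [hermitePoly_zero]
  | succ n ih =>
    have h : (derivative (hermitePoly R n)).comp (-X) =
        -derivative ((hermitePoly R n).comp (-X)) := by
      rw [derivative_comp]; simp
    have h' : derivative ((-1) ^ n * hermitePoly R n) =
        (-1) ^ n * derivative (hermitePoly R n) := by
      have : ((-1 : R[X]) ^ n) = C ((-1) ^ n) := by simp
      rw [this, derivative_C_mul]
    rw [hermitePoly_succ, sub_comp, mul_comp, mul_comp, h, ih, h']
    simp
    ring

/-- The shift `X ↦ X + y` turns the raising operator into itself plus the scalar `2y`; the two
commute, so the binomial theorem expands the `n`-th power. -/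
lemma hermitePoly_comp_X_add (n : ℕ) (y : R) :
    (hermitePoly R n).comp (X + C y) = ∑ k ∈ Finset.range (n + 1),
      C ((2 * y) ^ (n - k) * n.choose k) * hermitePoly R k := by
  have h : (hermitePoly R n).comp (X + C y) =
      ((raising R + algebraMap R (Module.End R R[X]) (2 * y)) ^ n) 1 := by
    induction n with
    | zero => simp [hermitePoly_zero]
    | succ n ih =>
      rw [pow_succ', Module.End.mul_apply, ← ih, hermitePoly_succ]
      have hd : (derivative (hermitePoly R n)).comp (X + C y) =
          derivative ((hermitePoly R n).comp (X + C y)) := by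
        rw [derivative_comp]; simp
      simp only [sub_comp, mul_comp, hd, raising, LinearMap.add_apply, LinearMap.sub_apply,
        LinearMap.mulLeft_apply, Module.algebraMap_end_apply, X_comp, ofNat_comp, smul_eq_C_mul,
        C_mul, C_ofNat]
      simp
      ring
  rw [h, (Commute.symm (Algebra.commutes (2 * y) (raising R))).add_pow, LinearMap.sum_apply]
  refine Finset.sum_congr rfl fun k _ => ?_
  rw [← map_pow, mul_assoc, Module.End.mul_apply, Module.End.mul_apply]
  have h1 : ((n.choose k : ℕ) : Module.End R R[X]) 1 = C ((n.choose k : R)) := by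
    rw [Module.End.natCast_apply]; simp
  have h2 : ∀ a : R, (raising R ^ k) (C a) = C a * hermitePoly R k := fun a => by
    rw [← mul_one (C a), ← smul_eq_C_mul, map_smul, smul_mul_assoc, one_mul, hermitePoly]
  rw [h1, Module.algebraMap_end_apply, smul_eq_C_mul, ← C_mul, h2]

variable (M : R[X] →ₗ[R] R) (hM : ∀ p, M (derivative p) = M (2 * X * p))
include hM

/-- The hypothesis `hM` is integration by parts against `e^{-x²}`: it makes the raising operator
adjoint to differentiation. -/
lemma functional_hermitePoly_mul (n : ℕ) (q : R[X]) :
    M (hermitePoly R n * q) = M (derivative^[n] q) := by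
  induction n generalizing q with
  | zero => simp [hermitePoly_zero]
  | succ n ih =>
    rw [Function.iterate_succ_apply, ← ih, hermitePoly_succ]
    have := hM (hermitePoly R n * q)
    rw [derivative_mul] at this
    rw [show (2 * X * hermitePoly R n - derivative (hermitePoly R n)) * q =
      2 * X * (hermitePoly R n * q) - derivative (hermitePoly R n) * q by ring, map_sub, ← this,
      map_add]
    ring

lemma functional_hermitePoly (n : ℕ) (hn : n ≠ 0) : M (hermitePoly R n) = 0 := by
  obtain ⟨m, rfl⟩ := Nat.exists_eq_succ_of_ne_zero hn
  have := functional_hermitePoly_mul M hM (m + 1) 1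
  simpa [Function.iterate_succ_apply] using this

lemma functional_hermitePoly_mul_hermitePoly (k l : ℕ) :
    M (hermitePoly R k * hermitePoly R l) = if k = l then 2 ^ k * k.factorial * M 1 else 0 := by
  wlog h : k ≤ l generalizing k l
  · rw [mul_comm, this l k (by omega)]
    rw [if_neg (by omega), if_neg (by omega)]
  obtain ⟨m, rfl⟩ := Nat.exists_eq_add_of_le' h
  rw [functional_hermitePoly_mul M hM, iterate_derivative_hermitePoly_add]
  have : (2 ^ k * (m + k).descFactorial k : R[X]) =
    C (2 ^ k * (m + k).descFactorial k : R) := by simp [C_ofNat]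
  rw [this, ← smul_eq_C_mul, map_smul]
  split_ifs with h0
  · have : m = 0 := by omega
    subst this
    simp [hermitePoly_zero, Nat.descFactorial_self]
  · rw [functional_hermitePoly M hM m (by omega)]; simp

lemma functional_hermitePoly_comp_mul_comp (n : ℕ) (y z : R) :
    M ((hermitePoly R n).comp (X + C y) * (hermitePoly R n).comp (X + C z)) =
      ∑ k ∈ Finset.range (n + 1),
        (4 * (y * z)) ^ (n - k) * (n.choose k) ^ 2 * (2 ^ k * k.factorial) * M 1 := by
  rw [hermitePoly_comp_X_add, hermitePoly_comp_X_add, Finset.sum_mul_sum, map_sum]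
  refine Finset.sum_congr rfl fun k hk => ?_
  rw [map_sum, Finset.sum_eq_single k]
  · rw [mul_mul_mul_comm, ← C_mul, ← smul_eq_C_mul, map_smul,
      functional_hermitePoly_mul_hermitePoly M hM, if_pos rfl, smul_eq_mul,
      show 4 * (y * z) = (2 * y) * (2 * z) by ring, mul_pow (2 * y)]
    ring
  · intro l _ hl
    rw [mul_mul_mul_comm, ← C_mul, ← smul_eq_C_mul, map_smul,
      functional_hermitePoly_mul_hermitePoly M hM, if_neg hl.symm, smul_zero]
  · exact fun h => absurd hk h

end Hermite

/-! ### Laguerre polynomials from shifted Hermite polynomials -/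

section Laguerre

open Polynomial

/-- The Laguerre polynomial `L_n`. -/
def laguerrePoly (K : Type*) [Field K] (n : ℕ) : K[X] :=
  ∑ i ∈ Finset.range (n + 1), C ((-1 : K) ^ i * n.choose i / i.factorial) * X ^ i

lemma eval_laguerrePoly {K : Type*} [Field K] (n : ℕ) (x : K) :
    (laguerrePoly K n).eval x =
      ∑ i ∈ Finset.range (n + 1), (-1) ^ i * n.choose i / i.factorial * x ^ i := by
  simp [laguerrePoly, eval_finsetSum]

lemma laguerre_zero_order (n : ℕ) (x : ℝ) : laguerre n 0 x = (laguerrePoly ℝ n).eval x := by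
  rw [eval_laguerrePoly, laguerre]
  refine Finset.sum_congr rfl fun i hi => ?_
  rw [add_zero, Nat.choose_symm (by simpa [Nat.lt_succ_iff] using hi)]
  ring

lemma ofReal_eval_laguerrePoly (n : ℕ) (x : ℝ) :
    (((laguerrePoly ℝ n).eval x : ℝ) : ℂ) = (laguerrePoly ℂ n).eval (x : ℂ) := by
  simp [eval_laguerrePoly]

/-- Orthogonality leaves a single sum; reversing its index `k ↦ n - k` gives the coefficients of
`L_n`. -/
lemma functional_hermitePoly_comp_eq_laguerrePoly {K : Type*} [Field K] [CharZero K]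
    (M : K[X] →ₗ[K] K) (hM : ∀ p, M (derivative p) = M (2 * X * p)) (n : ℕ) (y z : K) :
    M ((hermitePoly K n).comp (X + C y) * (hermitePoly K n).comp (X + C z)) =
      2 ^ n * n.factorial * (laguerrePoly K n).eval (-2 * (y * z)) * M 1 := by
  rw [functional_hermitePoly_comp_mul_comp M hM, eval_laguerrePoly, Finset.mul_sum, Finset.sum_mul,
    ← Finset.sum_range_reflect]
  refine Finset.sum_congr rfl fun i hi => ?_
  have hi' : i ≤ n := by simpa [Nat.lt_succ_iff] using hi
  obtain ⟨m, rfl⟩ := Nat.exists_eq_add_of_le hi'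
  rw [show i + m + 1 - 1 - i = m by omega, show i + m - m = i by omega]
  have h1 : ((i + m).choose m : K) * (m.factorial * i.factorial) = (i + m).factorial := by
    have := Nat.add_choose_mul_factorial_mul_factorial i m
    rw [← this]; push_cast; ring
  have h2 : ((i + m).choose i : K) = (i + m).choose m := by rw [Nat.choose_symm_add]
  have h3 : (i.factorial : K) ≠ 0 := by exact_mod_cast i.factorial_ne_zero
  rw [h2, ← h1, show -2 * (y * z) = (-1) * (2 * (y * z)) by ring, mul_pow (-1 : K),
    show 4 * (y * z) = 2 * (2 * (y * z)) by ring, mul_pow (2 : K), pow_add]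
  have h4 : ((-1 : K) ^ i) * (-1) ^ i = 1 := by rw [← mul_pow]; simp
  field_simp
  linear_combination
    (-(y * z) ^ i * ((i + m).choose m : K) ^ 2 * m.factorial * M 1 * 2 ^ i) * h4
end Laguerre

/-! ### Gaussian integrals along horizontal lines of the complex plane -/

section Gaussian

open Polynomial

lemma integrable_pow_mul_gaussian {b : ℝ} (hb : 0 < b) (n : ℕ) :
    Integrable fun x : ℝ => x ^ n * Real.exp (-b * x ^ 2) := by
  simpa using integrable_rpow_mul_exp_neg_mul_sq hb (s := n) (by
    have : (0 : ℝ) ≤ n := n.cast_nonneg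
    linarith)

lemma integrable_eval_mul_gaussian {b : ℝ} (hb : 0 < b) (p : ℂ[X]) :
    Integrable fun x : ℝ => p.eval (x : ℂ) * ((Real.exp (-b * x ^ 2) : ℝ) : ℂ) := by
  simp_rw [eval_eq_sum_range, Finset.sum_mul]
  refine integrable_finsetSum _ fun i _ => ?_
  have := ((integrable_pow_mul_gaussian hb i).ofReal (𝕜 := ℂ)).const_mul (p.coeff i)
  refine this.congr (Filter.Eventually.of_forall fun x => ?_)
  simp
  ring

lemma integrable_eval_mul_cexp (c : ℝ) (p : ℂ[X]) :
    Integrable fun x : ℝ => p.eval (x + c * Complex.I) *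
      Complex.exp (-(x + c * Complex.I) ^ 2) := by
  have h1 := integrable_eval_mul_gaussian (b := 1) one_pos (p.comp (X + C (c * Complex.I)))
  have h2 : Integrable fun x : ℝ => Complex.exp (c ^ 2 - 2 * c * x * Complex.I) *
      ((p.comp (X + C (c * Complex.I))).eval (x : ℂ) *
        ((Real.exp (-1 * x ^ 2) : ℝ) : ℂ)) := by
    refine h1.bdd_mul (c := Real.exp (c ^ 2)) (by fun_prop) (Filter.Eventually.of_forall fun x => ?_)
    rw [Complex.norm_exp]
    simp [← Complex.ofReal_pow]
  refine h2.congr (Filter.Eventually.of_forall fun x => ?_)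
  simp only [eval_comp, eval_add, eval_X, eval_C]
  rw [mul_left_comm, Complex.ofReal_exp, ← Complex.exp_add]
  congr 2
  push_cast
  linear_combination (c ^ 2 : ℂ) * Complex.I_sq

/-- Integration of a polynomial against the Gaussian on the horizontal line of height `c`. -/
def gaussianFunctional (c : ℝ) : ℂ[X] →ₗ[ℂ] ℂ where
  toFun p := ∫ x : ℝ, p.eval (x + c * Complex.I) * Complex.exp (-(x + c * Complex.I) ^ 2)
  map_add' p q := by
    rw [← integral_add (integrable_eval_mul_cexp c p) (integrable_eval_mul_cexp c q)]
    simp [add_mul]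
  map_smul' a p := by
    rw [RingHom.id_apply, smul_eq_mul, ← integral_const_mul]
    simp [mul_assoc]

lemma gaussianFunctional_apply (c : ℝ) (p : ℂ[X]) : gaussianFunctional c p =
    ∫ x : ℝ, p.eval (x + c * Complex.I) * Complex.exp (-(x + c * Complex.I) ^ 2) := rfl

/-- The difference of the two sides integrates the derivative of `p(z) e^{-z²}` along the line,
hence vanishes. No contour shift is needed. -/
lemma gaussianFunctional_derivative (c : ℝ) (p : ℂ[X]) :
    gaussianFunctional c (derivative p) = gaussianFunctional c (2 * X * p) := by
  rw [← sub_eq_zero, ← map_sub]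
  refine integral_eq_zero_of_hasDerivAt_of_integrable
    (f := fun x : ℝ => p.eval (x + c * Complex.I) * Complex.exp (-(x + c * Complex.I) ^ 2))
    (fun x => ?_) (integrable_eval_mul_cexp c _) (integrable_eval_mul_cexp c p)
  have h0 : HasDerivAt (fun z : ℂ => p.eval (z + c * Complex.I) *
      Complex.exp (-(z + c * Complex.I) ^ 2))
      ((derivative p - 2 * X * p).eval (x + c * Complex.I) *
        Complex.exp (-(x + c * Complex.I) ^ 2)) (x : ℂ) := by
    have h1 : HasDerivAt (fun z : ℂ => z + c * Complex.I) 1 (x : ℂ) :=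
      (hasDerivAt_id _).add_const _
    have h2 := (p.hasDerivAt (x + c * Complex.I)).comp (x : ℂ) h1
    have h3 := ((h1.pow 2).neg).cexp
    refine (h2.mul h3).congr_deriv ?_
    simp
    ring
  exact h0.comp_ofReal

lemma gaussianFunctional_one (c : ℝ) : gaussianFunctional c 1 = (√Real.pi : ℝ) := by
  have := GaussianFourier.integral_cexp_neg_mul_sq_add_real_mul_I (b := 1) (by simp) c
  rw [gaussianFunctional_apply]
  simp only [eval_one, one_mul]
  simp only [neg_mul, one_mul, div_one] at this
  rw [this, Real.sqrt_eq_rpow, Complex.ofReal_cpow Real.pi_pos.le]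
  simp

/-- The Gaussian integral of a product of two shifted Hermite polynomials of the same degree. -/
lemma integral_hermitePoly_mul_hermitePoly (c : ℝ) (n : ℕ) (y z : ℂ) :
    ∫ x : ℝ, (hermitePoly ℂ n).eval (x + c * Complex.I + y) *
        (hermitePoly ℂ n).eval (x + c * Complex.I + z) *
        Complex.exp (-(x + c * Complex.I) ^ 2) =
      2 ^ n * n.factorial * (laguerrePoly ℂ n).eval (-2 * (y * z)) * (√Real.pi : ℝ) := by
  rw [← gaussianFunctional_one c, ← functional_hermitePoly_comp_eq_laguerrePoly _
    (gaussianFunctional_derivative c), gaussianFunctional_apply]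
  simp

end Gaussian

/-! ### Fourier transforms of products of Fock functions -/

section Fock

open Polynomial

lemma iteratedDeriv_gaussian (n : ℕ) (x : ℝ) :
    iteratedDeriv n (fun y : ℝ => Real.exp (-y ^ 2)) x =
      (-1) ^ n * (hermitePoly ℝ n).eval x * Real.exp (-x ^ 2) := by
  induction n generalizing x with
  | zero => simp [hermitePoly_zero]
  | succ n ih =>
    rw [iteratedDeriv_succ, funext ih, hermitePoly_succ]
    have h1 := (hasDerivAt_id x).pow 2 |>.neg.exp
    have h2 := (((hermitePoly ℝ n).hasDerivAt x).const_mul ((-1) ^ n)).mul h1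
    refine (h2.congr_deriv ?_).deriv
    simp
    ring

lemma hermiteH_eq (n : ℕ) (x : ℝ) : hermiteH n x = (hermitePoly ℝ n).eval x := by
  rw [hermiteH, iteratedDeriv_gaussian]
  have h1 : Real.exp (x ^ 2) * Real.exp (-x ^ 2) = 1 := by rw [← Real.exp_add]; simp
  have h2 : ((-1 : ℝ) ^ n) * (-1) ^ n = 1 := by rw [← mul_pow]; simp
  linear_combination (hermitePoly ℝ n).eval x * (-1) ^ n * (-1) ^ n * h1 +
    (hermitePoly ℝ n).eval x * h2

lemma ofReal_eval_hermitePoly (n : ℕ) (x : ℝ) :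
    (((hermitePoly ℝ n).eval x : ℝ) : ℂ) = (hermitePoly ℂ n).eval (x : ℂ) := by
  rw [← map_hermitePoly (algebraMap ℝ ℂ) n, eval_map_algebraMap]
  exact (aeval_algebraMap_apply ℂ x (hermitePoly ℝ n)).symm

/-- A product of two values of a Fock basis function, with the normalisation made explicit. -/
lemma fockBasis_mul_fockBasis (n : ℕ) (x y : ℝ) :
    fockBasis n x * fockBasis n y = 1 / (√Real.pi * 2 ^ n * n.factorial) *
      ((hermitePoly ℝ n).eval x * (hermitePoly ℝ n).eval y * Real.exp (-(x ^ 2 + y ^ 2) / 2)) := by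
  have h1 : (0 : ℝ) ≤ √Real.pi * 2 ^ n * n.factorial := by positivity
  have h2 : Real.exp (-(x ^ 2 + y ^ 2) / 2) = Real.exp (-x ^ 2 / 2) * Real.exp (-y ^ 2 / 2) := by
    rw [← Real.exp_add]; congr 1; ring
  rw [fockBasis, fockBasis, hermiteH_eq, hermiteH_eq, h2, ← Real.mul_self_sqrt h1,
    Real.sqrt_mul_self (Real.sqrt_nonneg _)]
  ring

lemma continuous_fockBasis (n : ℕ) : Continuous (fockBasis n) := by
  have : fockBasis n = fun x => 1 / √(√Real.pi * 2 ^ n * (n.factorial : ℝ)) *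
      (hermitePoly ℝ n).eval x * Real.exp (-x ^ 2 / 2) := by
    ext x; rw [fockBasis, hermiteH_eq]
  rw [this]
  fun_prop

/-- The cross-Wigner integral in the position variable. -/
lemma integral_fockBasis_position (n : ℕ) (u v : ℝ) :
    ∫ x : ℝ, ((fockBasis n (x - v / 2) * fockBasis n (x + v / 2) : ℝ) : ℂ) *
        Complex.exp (Complex.I * ((u * x : ℝ) : ℂ)) =
      ((Real.exp (-(u ^ 2 + v ^ 2) / 4) * (laguerrePoly ℝ n).eval ((u ^ 2 + v ^ 2) / 2) : ℝ) : ℂ) := by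
  -- Completing the square, `-x² - v²/4 + iux = -(x - iu/2)² - (u² + v²)/4`, fixes the height
  -- `-u/2`; the offsets restore the arguments `x ∓ v/2`.
  have key := integral_hermitePoly_mul_hermitePoly (-u / 2) n (u / 2 * Complex.I - v / 2)
    (u / 2 * Complex.I + v / 2)
  have hpt : ∀ x : ℝ, ((fockBasis n (x - v / 2) * fockBasis n (x + v / 2) : ℝ) : ℂ) *
        Complex.exp (Complex.I * ((u * x : ℝ) : ℂ)) =
      ((1 / (√Real.pi * 2 ^ n * n.factorial) * Real.exp (-(u ^ 2 + v ^ 2) / 4) : ℝ) : ℂ) *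
      ((hermitePoly ℂ n).eval (x + ((-u / 2 : ℝ) : ℂ) * Complex.I + (u / 2 * Complex.I - v / 2)) *
        (hermitePoly ℂ n).eval (x + ((-u / 2 : ℝ) : ℂ) * Complex.I + (u / 2 * Complex.I + v / 2)) *
        Complex.exp (-(x + ((-u / 2 : ℝ) : ℂ) * Complex.I) ^ 2)) := by
    intro x
    rw [fockBasis_mul_fockBasis]
    have e1 : (x : ℂ) + ((-u / 2 : ℝ) : ℂ) * Complex.I + (u / 2 * Complex.I - v / 2) =
        ((x - v / 2 : ℝ) : ℂ) := by push_cast; ring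
    have e2 : (x : ℂ) + ((-u / 2 : ℝ) : ℂ) * Complex.I + (u / 2 * Complex.I + v / 2) =
        ((x + v / 2 : ℝ) : ℂ) := by push_cast; ring
    rw [e1, e2, ← ofReal_eval_hermitePoly, ← ofReal_eval_hermitePoly]
    have e3 : ((Real.exp (-((x - v / 2) ^ 2 + (x + v / 2) ^ 2) / 2) : ℝ) : ℂ) *
        Complex.exp (Complex.I * ((u * x : ℝ) : ℂ)) =
        ((Real.exp (-(u ^ 2 + v ^ 2) / 4) : ℝ) : ℂ) *
          Complex.exp (-(x + ((-u / 2 : ℝ) : ℂ) * Complex.I) ^ 2) := by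
      rw [Complex.ofReal_exp, Complex.ofReal_exp, ← Complex.exp_add, ← Complex.exp_add]
      congr 1
      push_cast
      linear_combination (u ^ 2 / 4 : ℂ) * Complex.I_sq
    push_cast at e3 ⊢
    linear_combination (1 / (((√Real.pi : ℝ) : ℂ) * 2 ^ n * n.factorial) *
      (((hermitePoly ℝ n).eval (x - v / 2) : ℝ) * ((hermitePoly ℝ n).eval (x + v / 2) : ℝ))) * e3
  simp_rw [hpt]
  rw [integral_const_mul, key]
  have e4 : (-2 * ((u / 2 * Complex.I - v / 2) * (u / 2 * Complex.I + v / 2)) : ℂ) =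
      (((u ^ 2 + v ^ 2) / 2 : ℝ) : ℂ) := by
    push_cast
    linear_combination (-u ^ 2 / 2 : ℂ) * Complex.I_sq
  rw [e4, ← ofReal_eval_laguerrePoly]
  have h0 : ((√Real.pi : ℝ) : ℂ) ≠ 0 := by
    exact_mod_cast (Real.sqrt_pos.2 Real.pi_pos).ne'
  have h1 : (n.factorial : ℂ) ≠ 0 := by exact_mod_cast n.factorial_ne_zero
  push_cast
  field_simp

/-- The cross-Wigner integral in the difference variable. -/
lemma integral_fockBasis_difference (n : ℕ) (q p : ℝ) :
    ∫ v : ℝ, ((fockBasis n (q - v / 2) * fockBasis n (q + v / 2) : ℝ) : ℂ) *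
        Complex.exp (-(Complex.I * ((v * p : ℝ) : ℂ))) =
      ((2 * (-1) ^ n * Real.exp (-(q ^ 2 + p ^ 2)) *
        (laguerrePoly ℝ n).eval (2 * (q ^ 2 + p ^ 2)) : ℝ) : ℂ) := by
  -- After `v = 2x`, the square completes as `-x² - 2ixp = -(x + ip)² - p²`, hence height `p`.
  -- Parity of `H_n` replaces `q - x` by `x - q`, producing the sign `(-1)^n`.
  have key := integral_hermitePoly_mul_hermitePoly p n (-p * Complex.I - q) (-p * Complex.I + q)
  have hneg : ∀ x : ℝ, (((hermitePoly ℝ n).eval (q - x) : ℝ) : ℂ) =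
      (-1) ^ n * (hermitePoly ℂ n).eval ((x - q : ℝ) : ℂ) := by
    intro x
    have := congrArg (eval (x - q)) (hermitePoly_comp_neg_X (R := ℝ) n)
    simp only [eval_comp, eval_neg, eval_X, neg_sub, eval_mul, eval_pow, eval_one] at this
    rw [this, ← ofReal_eval_hermitePoly]
    push_cast; ring
  have hpt : ∀ x : ℝ, ((fockBasis n (q - x) * fockBasis n (q + x) : ℝ) : ℂ) *
        Complex.exp (-(Complex.I * ((2 * x * p : ℝ) : ℂ))) =
      (((-1) ^ n / (√Real.pi * 2 ^ n * n.factorial) * Real.exp (-(q ^ 2 + p ^ 2)) : ℝ) : ℂ) *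
      ((hermitePoly ℂ n).eval (x + (p : ℂ) * Complex.I + (-p * Complex.I - q)) *
        (hermitePoly ℂ n).eval (x + (p : ℂ) * Complex.I + (-p * Complex.I + q)) *
        Complex.exp (-(x + (p : ℂ) * Complex.I) ^ 2)) := by
    intro x
    rw [fockBasis_mul_fockBasis]
    have e1 : (x : ℂ) + (p : ℂ) * Complex.I + (-p * Complex.I - q) =
        ((x - q : ℝ) : ℂ) := by push_cast; ring
    have e2 : (x : ℂ) + (p : ℂ) * Complex.I + (-p * Complex.I + q) =
        ((q + x : ℝ) : ℂ) := by push_cast; ring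
    rw [e1, e2]
    have e3 : ((Real.exp (-((q - x) ^ 2 + (q + x) ^ 2) / 2) : ℝ) : ℂ) *
        Complex.exp (-(Complex.I * ((2 * x * p : ℝ) : ℂ))) =
        ((Real.exp (-(q ^ 2 + p ^ 2)) : ℝ) : ℂ) *
          Complex.exp (-(x + (p : ℂ) * Complex.I) ^ 2) := by
      rw [Complex.ofReal_exp, Complex.ofReal_exp, ← Complex.exp_add, ← Complex.exp_add]
      congr 1
      push_cast
      linear_combination (p ^ 2 : ℂ) * Complex.I_sq
    have e4 := hneg x
    have e5 := ofReal_eval_hermitePoly n (q + x)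
    push_cast at e3 e4 e5 ⊢
    rw [e4, e5]
    linear_combination (1 / (((√Real.pi : ℝ) : ℂ) * 2 ^ n * n.factorial) *
      (-1) ^ n * (hermitePoly ℂ n).eval ((x : ℂ) - q) * (hermitePoly ℂ n).eval ((q : ℂ) + x)) * e3
  have hsub := Measure.integral_comp_mul_left (fun v : ℝ =>
    ((fockBasis n (q - v / 2) * fockBasis n (q + v / 2) : ℝ) : ℂ) *
        Complex.exp (-(Complex.I * ((v * p : ℝ) : ℂ)))) 2
  simp only [mul_div_cancel_left₀ _ (two_ne_zero' ℝ)] at hsub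
  simp_rw [hpt] at hsub
  rw [integral_const_mul, key] at hsub
  have e4 : (-2 * ((-p * Complex.I - q) * (-p * Complex.I + q)) : ℂ) =
      ((2 * (q ^ 2 + p ^ 2) : ℝ) : ℂ) := by
    push_cast
    linear_combination (-2 * p ^ 2 : ℂ) * Complex.I_sq
  rw [e4, ← ofReal_eval_laguerrePoly] at hsub
  have h0 : ((√Real.pi : ℝ) : ℂ) ≠ 0 := by
    exact_mod_cast (Real.sqrt_pos.2 Real.pi_pos).ne'
  have h1 : (n.factorial : ℂ) ≠ 0 := by exact_mod_cast n.factorial_ne_zero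
  have h2 : ∀ z w : ℂ, z = |(2 : ℝ)⁻¹| • w → w = 2 * z := by
    intro z w h
    rw [h, abs_of_pos (by norm_num)]
    simp
  rw [h2 _ _ hsub]
  push_cast
  field_simp

lemma weylEntry_self (n : ℕ) (u v : ℝ) : weylEntry u v n n =
    ((Real.exp (-(u ^ 2 + v ^ 2) / 4) * (laguerrePoly ℝ n).eval ((u ^ 2 + v ^ 2) / 2) : ℝ) : ℂ) := by
  -- Translating by `v/2` makes the product symmetric and absorbs the Weyl phase `uv/2`.
  rw [← integral_fockBasis_position, weylEntry, ← integral_sub_right_eq_self _ (v / 2)]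
  refine integral_congr_ae (Filter.Eventually.of_forall fun x => ?_)
  simp only [weyl]
  rw [show x - v / 2 + v = x + v / 2 by ring,
    show u * v / 2 + u * (x - v / 2) = u * x by ring]
  push_cast
  ring

lemma wignerFourier_fockState (n : ℕ) (u v : ℝ) : wignerFourier (fockState n) u v =
    ((Real.exp (-(u ^ 2 + v ^ 2) / 4) * (laguerrePoly ℝ n).eval ((u ^ 2 + v ^ 2) / 2) : ℝ) : ℂ) := by
  rw [← weylEntry_self, wignerFourier, tsum_eq_single n, tsum_eq_single n]
  · simp [fockState]
  · intro k hk; simp [fockState, hk]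
  · intro j hj; simp [fockState, hj]

end Fock

/-! ### Wigner function and quadrature density of a Fock state -/

section Wigner

open Polynomial FourierTransform

/-- Fourier inversion on the real line, with the angular frequency convention. -/
lemma integral_fourier_inversion {f F : ℝ → ℂ} (hc : Continuous f) (hf : Integrable f)
    (hF : ∀ u, ∫ x : ℝ, f x * Complex.exp (Complex.I * ((u * x : ℝ) : ℂ)) = F u)
    (hFi : Integrable F) (x : ℝ) :
    ∫ u : ℝ, F u * Complex.exp (-(Complex.I * ((u * x : ℝ) : ℂ))) = 2 * Real.pi * f x := by
  have hpi : (2 * Real.pi) ≠ 0 := by positivity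
  have h1 : ∀ w : ℝ, 𝓕 f w = F (-(2 * Real.pi) * w) := by
    intro w
    rw [Real.fourier_eq', ← hF]
    refine integral_congr_ae (Filter.Eventually.of_forall fun y => ?_)
    simp only [smul_eq_mul, RCLike.inner_apply, conj_trivial]
    rw [mul_comm]
    congr 2
    push_cast; ring
  have h2 : Integrable (𝓕 f) := by
    rw [show 𝓕 f = fun w => F (-(2 * Real.pi) * w) from funext h1]
    exact hFi.comp_mul_left' (neg_ne_zero.2 hpi)
  have h3 := congrFun (hc.fourierInv_fourier_eq hf h2) x
  rw [← h3, Real.fourierInv_eq', funext h1]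
  have h4 := Measure.integral_comp_mul_left (fun u : ℝ =>
    F u * Complex.exp (-(Complex.I * ((u * x : ℝ) : ℂ)))) (-(2 * Real.pi))
  have h5 : ∀ w : ℝ, Complex.exp (((2 * Real.pi * inner ℝ w x : ℝ) : ℂ) * Complex.I) •
      F (-(2 * Real.pi) * w) = F (-(2 * Real.pi) * w) *
        Complex.exp (-(Complex.I * ((-(2 * Real.pi) * w * x : ℝ) : ℂ))) := by
    intro w
    simp only [smul_eq_mul, RCLike.inner_apply, conj_trivial]
    rw [mul_comm]
    congr 2
    push_cast; ring
  simp_rw [h5]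
  rw [h4, abs_inv, abs_neg, abs_of_pos (by positivity), Complex.real_smul]
  generalize (∫ u : ℝ, F u * Complex.exp (-(Complex.I * ((u * x : ℝ) : ℂ)))) = J
  push_cast
  have : (Real.pi : ℂ) ≠ 0 := by exact_mod_cast Real.pi_ne_zero
  field_simp

lemma integrable_real_eval_mul_gaussian {b : ℝ} (hb : 0 < b) (p : ℝ[X]) :
    Integrable fun x : ℝ => p.eval x * Real.exp (-b * x ^ 2) := by
  simp_rw [eval_eq_sum_range, Finset.sum_mul]
  refine integrable_finsetSum _ fun i _ => ?_
  simpa [mul_assoc] using (integrable_pow_mul_gaussian hb i).const_mul (p.coeff i)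

lemma integrable_radial_eval_mul_gaussian {b : ℝ} (hb : 0 < b) (p : ℝ[X]) :
    Integrable fun w : ℝ × ℝ => p.eval (w.1 ^ 2 + w.2 ^ 2) *
      Real.exp (-b * (w.1 ^ 2 + w.2 ^ 2)) := by
  have h : ∀ w : ℝ × ℝ, p.eval (w.1 ^ 2 + w.2 ^ 2) * Real.exp (-b * (w.1 ^ 2 + w.2 ^ 2)) =
      ∑ i ∈ Finset.range (p.natDegree + 1), ∑ k ∈ Finset.range (i + 1),
        (p.coeff i * i.choose k) * ((w.1 ^ (2 * k) * Real.exp (-b * w.1 ^ 2)) *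
          (w.2 ^ (2 * (i - k)) * Real.exp (-b * w.2 ^ 2))) := by
    intro w
    rw [eval_eq_sum_range, Finset.sum_mul]
    refine Finset.sum_congr rfl fun i _ => ?_
    rw [add_pow, Finset.mul_sum, Finset.sum_mul]
    refine Finset.sum_congr rfl fun k _ => ?_
    rw [mul_add, Real.exp_add, pow_mul, pow_mul]
    ring
  simp_rw [h]
  refine integrable_finsetSum _ fun i _ => integrable_finsetSum _ fun k _ => ?_
  exact ((integrable_pow_mul_gaussian hb (2 * k)).mul_prod
    (integrable_pow_mul_gaussian hb (2 * (i - k)))).const_mul _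

lemma integrable_wignerFourier_fockState (n : ℕ) :
    Integrable fun w : ℝ × ℝ => wignerFourier (fockState n) w.1 w.2 := by
  simp_rw [wignerFourier_fockState]
  have := integrable_radial_eval_mul_gaussian (b := 1 / 4) (by norm_num)
    ((laguerrePoly ℝ n).comp (C (1 / 2) * X))
  refine (this.congr (Filter.Eventually.of_forall fun w => ?_)).ofReal
  simp only [eval_comp, eval_mul, eval_C, eval_X]
  rw [mul_comm]
  congr 2 <;> ring

lemma integrable_wignerFourier_fockState_left (n : ℕ) (v : ℝ) :
    Integrable fun u : ℝ => wignerFourier (fockState n) u v := by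
  simp_rw [wignerFourier_fockState]
  have := (integrable_real_eval_mul_gaussian (b := 1 / 4) (by norm_num)
    ((laguerrePoly ℝ n).comp (C (1 / 2) * (X ^ 2 + C (v ^ 2))))).mul_const (Real.exp (-v ^ 2 / 4))
  refine (this.congr (Filter.Eventually.of_forall fun w => ?_)).ofReal
  simp only [eval_comp, eval_mul, eval_C, eval_X, eval_add, eval_pow]
  rw [mul_assoc, ← Real.exp_add, mul_comm]
  congr 2 <;> ring

lemma integrable_fockBasis_mul (n : ℕ) (v : ℝ) :
    Integrable fun x : ℝ => fockBasis n (x - v / 2) * fockBasis n (x + v / 2) := by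
  have := ((integrable_real_eval_mul_gaussian (b := 1) (by norm_num)
    ((hermitePoly ℝ n).comp (X - C (v / 2)) * (hermitePoly ℝ n).comp (X + C (v / 2)))).mul_const
      (Real.exp (-v ^ 2 / 4))).const_mul (1 / (√Real.pi * 2 ^ n * n.factorial))
  refine this.congr (Filter.Eventually.of_forall fun x => ?_)
  simp only [eval_comp, eval_mul, eval_C, eval_X, eval_add, eval_sub]
  rw [mul_assoc _ (Real.exp _), ← Real.exp_add, fockBasis_mul_fockBasis]
  congr 3; ring

lemma integrable_fockBasis_mul_difference (n : ℕ) (q : ℝ) :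
    Integrable fun v : ℝ => fockBasis n (q - v / 2) * fockBasis n (q + v / 2) := by
  have := ((integrable_real_eval_mul_gaussian (b := 1 / 4) (by norm_num)
    ((hermitePoly ℝ n).comp (C q - C (1 / 2) * X) *
      (hermitePoly ℝ n).comp (C q + C (1 / 2) * X))).mul_const
      (Real.exp (-q ^ 2))).const_mul (1 / (√Real.pi * 2 ^ n * n.factorial))
  refine this.congr (Filter.Eventually.of_forall fun x => ?_)
  simp only [eval_comp, eval_mul, eval_C, eval_X, eval_add, eval_sub]
  rw [mul_assoc _ (Real.exp _), ← Real.exp_add, fockBasis_mul_fockBasis]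
  have e1 : eval (q - 1 / 2 * x) (hermitePoly ℝ n) = eval (q - x / 2) (hermitePoly ℝ n) := by
    congr 1; ring
  have e2 : eval (q + 1 / 2 * x) (hermitePoly ℝ n) = eval (q + x / 2) (hermitePoly ℝ n) := by
    congr 1; ring
  rw [e1, e2]
  congr 3; ring

/-- The Wigner function of a Fock state. -/
lemma wigner_fockState (n : ℕ) (q p : ℝ) : wigner (fockState n) q p =
    1 / Real.pi * ((-1) ^ n * Real.exp (-(q ^ 2 + p ^ 2)) *
        (laguerrePoly ℝ n).eval (2 * (q ^ 2 + p ^ 2))) := by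
  have hint : Integrable (fun w : ℝ × ℝ =>
      Complex.exp (-(Complex.I * ((w.1 * q + w.2 * p : ℝ) : ℂ))) *
        wignerFourier (fockState n) w.1 w.2) := by
    refine (integrable_wignerFourier_fockState n).bdd_mul (c := 1) (by fun_prop)
      (Filter.Eventually.of_forall fun w => ?_)
    rw [Complex.norm_exp]
    simp
  -- Inversion in `u` alone recovers the product of shifted Fock functions; the `v`-integral left
  -- over is the difference integral.
  have hinner : ∀ v : ℝ, ∫ u : ℝ, Complex.exp (-(Complex.I * ((u * q + v * p : ℝ) : ℂ))) *
        wignerFourier (fockState n) u v =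
      2 * Real.pi * (((fockBasis n (q - v / 2) * fockBasis n (q + v / 2) : ℝ) : ℂ) *
        Complex.exp (-(Complex.I * ((v * p : ℝ) : ℂ)))) := by
    intro v
    have h1 := integral_fourier_inversion
      (f := fun x => ((fockBasis n (x - v / 2) * fockBasis n (x + v / 2) : ℝ) : ℂ))
      (F := fun u => wignerFourier (fockState n) u v)
      (by have := continuous_fockBasis n; fun_prop) (integrable_fockBasis_mul n v).ofReal
      (fun u => by rw [wignerFourier_fockState, integral_fockBasis_position])
      (integrable_wignerFourier_fockState_left n v) q
    rw [← mul_assoc, ← h1, ← integral_mul_const]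
    refine integral_congr_ae (Filter.Eventually.of_forall fun u => ?_)
    simp only
    rw [mul_assoc, ← Complex.exp_add, mul_comm]
    congr 2
    push_cast; ring
  rw [wigner, Measure.volume_eq_prod, integral_prod_symm _ (by rwa [← Measure.volume_eq_prod])]
  simp_rw [hinner]
  rw [integral_const_mul, integral_fockBasis_difference, ← Complex.ofReal_ofNat, ← Complex.ofReal_mul,
    ← Complex.ofReal_mul, ← Complex.ofReal_pow, ← Complex.ofReal_one, ← Complex.ofReal_div,
    ← Complex.ofReal_mul, Complex.ofReal_re]
  have := Real.pi_ne_zero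
  field_simp

/-- The quadratures of a Fock state have density `ψ_n ^ 2`, for every phase. -/
lemma quadratureDensity_fockState (n : ℕ) (x φ : ℝ) :
    quadratureDensity (fockState n) x φ = fockBasis n x ^ 2 := by
  have hW : ∀ t : ℝ, wigner (fockState n) (x * Real.cos φ - t * Real.sin φ)
      (x * Real.sin φ + t * Real.cos φ) = 1 / Real.pi * ((-1) ^ n * Real.exp (-(x ^ 2 + t ^ 2)) *
        (laguerrePoly ℝ n).eval (2 * (x ^ 2 + t ^ 2))) := by
    intro t
    have h : (x * Real.cos φ - t * Real.sin φ) ^ 2 + (x * Real.sin φ + t * Real.cos φ) ^ 2 =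
        x ^ 2 + t ^ 2 := by
      linear_combination (x ^ 2 + t ^ 2) * Real.sin_sq_add_cos_sq φ
    rw [wigner_fockState, h]
  -- The integral over `t` is the inverse transform of the difference integral at `v = 0`, where the
  -- product is `ψ_n(x)²`.
  have h1 := integral_fourier_inversion
      (f := fun v => ((fockBasis n (x - v / 2) * fockBasis n (x + v / 2) : ℝ) : ℂ))
      (F := fun t => ((2 * (-1) ^ n * Real.exp (-(x ^ 2 + t ^ 2)) *
        (laguerrePoly ℝ n).eval (2 * (x ^ 2 + t ^ 2)) : ℝ) : ℂ))
      (by have := continuous_fockBasis n; fun_prop) (integrable_fockBasis_mul_difference n x).ofReal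
      (fun u => by
        rw [← neg_sq u, ← integral_fockBasis_difference]
        refine integral_congr_ae (Filter.Eventually.of_forall fun v => ?_)
        simp only
        congr 2
        push_cast; ring)
      (by
        have := ((integrable_real_eval_mul_gaussian (b := 1) (by norm_num)
          ((laguerrePoly ℝ n).comp (C 2 * (C (x ^ 2) + X ^ 2)))).mul_const
            (Real.exp (-x ^ 2))).const_mul (2 * (-1) ^ n)
        refine (this.congr (Filter.Eventually.of_forall fun t => ?_)).ofReal
        simp only [eval_comp, eval_mul, eval_C, eval_X, eval_add, eval_pow]
        rw [mul_assoc _ (Real.exp _), ← Real.exp_add, mul_comm (eval _ _), ← mul_assoc,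
          show -1 * t ^ 2 + -x ^ 2 = -(x ^ 2 + t ^ 2) by ring]
        rfl) 0
  simp only [mul_zero, Complex.ofReal_zero, neg_zero, Complex.exp_zero, mul_one, zero_div,
    sub_zero, add_zero] at h1
  rw [integral_complex_ofReal, ← Complex.ofReal_ofNat, ← Complex.ofReal_mul, ← Complex.ofReal_mul,
    Complex.ofReal_inj] at h1
  simp_rw [quadratureDensity, hW]
  rw [integral_const_mul]
  have h2 : ∀ t : ℝ, (-1) ^ n * Real.exp (-(x ^ 2 + t ^ 2)) *
      (laguerrePoly ℝ n).eval (2 * (x ^ 2 + t ^ 2)) = 1 / 2 * (2 * (-1) ^ n *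
        Real.exp (-(x ^ 2 + t ^ 2)) * (laguerrePoly ℝ n).eval (2 * (x ^ 2 + t ^ 2))) := by
    intro t; ring
  simp_rw [h2]
  rw [integral_const_mul, h1]
  have := Real.pi_ne_zero
  field_simp

end Wigner

/-! ### Orthonormality of Laguerre polynomials -/

section LaguerreOrthogonality

open Polynomial Finset

/-- Up to the sign `(-1)^k`, the sum is the `k`-th forward difference of `x ↦ x.choose m`, a
polynomial of degree `m ≤ k`. -/
lemma sum_neg_one_pow_mul_choose_mul_choose_add (k m : ℕ) (h : m ≤ k) :
    ∑ i ∈ range (k + 1), (-1 : ℝ) ^ i * k.choose i * (m + i).choose m =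
      if m = k then (-1) ^ k else 0 := by
  have h1 := fwdDiff_iter_eq_sum_shift (1 : ℕ) (fun x : ℕ => (x.choose m : ℤ)) k m
  have h2 : (fwdDiff 1)^[k] (fun x : ℕ => (x.choose m : ℤ)) m = if m = k then 1 else 0 := by
    split_ifs with hmk
    · subst hmk
      have := congrFun (fwdDiff_iter_choose 0 m) m
      simpa using this
    · obtain ⟨r, rfl⟩ := Nat.exists_eq_add_of_lt (lt_of_le_of_ne h hmk)
      have h0 := fwdDiff_iter_choose 0 m
      simp only [add_zero, Nat.choose_zero_right, Nat.cast_one] at h0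
      rw [show m + r + 1 = r + (1 + m) by ring, Function.iterate_add_apply,
        Function.iterate_add_apply, h0, Function.iterate_one, fwdDiff_const]
      have h3 := fwdDiff_iter_const_smul (1 : ℕ) (0 : ℤ) (fun _ : ℕ => (0 : ℤ)) r
      rw [zero_smul, zero_smul] at h3
      exact congrFun h3 m
  rw [h2] at h1
  have h3 := congrArg (fun z : ℤ => (-1 : ℝ) ^ k * (z : ℝ)) h1
  simp only [Int.cast_sum] at h3
  rw [Finset.mul_sum] at h3
  have h4 : ∑ i ∈ range (k + 1), (-1 : ℝ) ^ i * k.choose i * (m + i).choose m =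
      (-1 : ℝ) ^ k * ((if m = k then 1 else 0 : ℤ) : ℝ) := by
    rw [h3]
    refine Finset.sum_congr rfl fun i hi => ?_
    obtain ⟨r, rfl⟩ := Nat.exists_eq_add_of_le (Nat.lt_succ_iff.1 (mem_range.1 hi))
    rw [Nat.add_sub_cancel_left]
    have h5 : ((-1 : ℝ) ^ r) * (-1) ^ r = 1 := by rw [← mul_pow]; simp
    simp only [smul_eq_mul, mul_one]
    push_cast
    rw [pow_add]
    linear_combination (-(-1) ^ i * ((i + r).choose i : ℝ) * ((m + i).choose m : ℝ)) * h5
  rw [h4]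
  split_ifs <;> simp

variable (M : ℝ[X] →ₗ[ℝ] ℝ) (hM : ∀ m, M (X ^ m) = m.factorial)
include hM

lemma functional_laguerrePoly_mul_X_pow (k m : ℕ) (h : m ≤ k) :
    M (laguerrePoly ℝ k * X ^ m) = if m = k then (-1 : ℝ) ^ k * k.factorial else 0 := by
  have h1 : M (laguerrePoly ℝ k * X ^ m) = m.factorial *
      ∑ i ∈ range (k + 1), (-1 : ℝ) ^ i * k.choose i * (m + i).choose m := by
    rw [laguerrePoly, Finset.sum_mul, map_sum, Finset.mul_sum]
    refine Finset.sum_congr rfl fun i _ => ?_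
    rw [mul_assoc, ← pow_add, ← smul_eq_C_mul, map_smul, hM, smul_eq_mul]
    have h2 : ((i + m).factorial : ℝ) = (m + i).choose m * m.factorial * i.factorial := by
      rw [add_comm i m, ← Nat.add_choose_mul_factorial_mul_factorial m i, Nat.choose_symm_add]
      push_cast
      ring
    have h3 : (i.factorial : ℝ) ≠ 0 := by exact_mod_cast i.factorial_ne_zero
    rw [h2]
    field_simp
  rw [h1, sum_neg_one_pow_mul_choose_mul_choose_add k m h]
  split_ifs with hmk
  · rw [hmk]; ring
  · simp

/-- Orthonormality of the Laguerre polynomials for a functional with moments `m!`. -/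
lemma functional_laguerrePoly_mul_laguerrePoly (j k : ℕ) :
    M (laguerrePoly ℝ j * laguerrePoly ℝ k) = if j = k then 1 else 0 := by
  wlog h : j ≤ k generalizing j k
  · rw [mul_comm, this k j (by omega)]
    simp only [eq_comm]
  rw [mul_comm]
  -- Only the factor of smaller degree is expanded, so at most its top power contributes.
  conv_lhs => rw [laguerrePoly.eq_1 ℝ j]
  rw [Finset.mul_sum, map_sum]
  have h1 : ∀ m ∈ range (j + 1), M (laguerrePoly ℝ k *
      (C ((-1 : ℝ) ^ m * j.choose m / m.factorial) * X ^ m)) =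
        if m = k then (j.choose k : ℝ) else 0 := by
    intro m hm
    rw [mul_left_comm, ← smul_eq_C_mul, map_smul,
      functional_laguerrePoly_mul_X_pow M hM k m (by have := mem_range.1 hm; omega)]
    split_ifs with hmk
    · subst hmk
      have h3 : (m.factorial : ℝ) ≠ 0 := by exact_mod_cast m.factorial_ne_zero
      have h5 : ((-1 : ℝ) ^ m) * (-1) ^ m = 1 := by rw [← mul_pow]; simp
      rw [smul_eq_mul]
      field_simp
      linear_combination (j.choose m : ℝ) * h5
    · simp
  rw [Finset.sum_congr rfl h1]
  rcases h.lt_or_eq with h | rfl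
  · rw [if_neg h.ne]
    refine Finset.sum_eq_zero fun m hm => if_neg ?_
    have := mem_range.1 hm
    omega
  · simp

end LaguerreOrthogonality

/-! ### Laguerre orthonormality in the variable `t ^ 2 / 2` -/

section LaguerreIntegral

open Polynomial

lemma integrable_abs_mul_eval_mul_gaussian {b : ℝ} (hb : 0 < b) (p : ℝ[X]) :
    Integrable fun t : ℝ => |t| * (p.eval t * Real.exp (-b * t ^ 2)) := by
  refine (integrable_real_eval_mul_gaussian hb (X * p)).mono (by fun_prop)
    (Filter.Eventually.of_forall fun t => ?_)
  simp [mul_assoc]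

lemma integral_abs_mul_sq_pow_mul_gaussian (m : ℕ) :
    ∫ t : ℝ, |t| * ((t ^ 2 / 2) ^ m * Real.exp (-(1 / 2) * t ^ 2)) = 2 * (m.factorial : ℝ) := by
  have h1 := integral_comp_abs (f := fun t : ℝ => t * ((t ^ 2 / 2) ^ m * Real.exp (-(1 / 2) * t ^ 2)))
  simp only [sq_abs] at h1
  rw [h1]
  have h2 := integral_rpow_mul_exp_neg_mul_rpow (p := 2) (q := (2 * m + 1 : ℕ)) (b := 1 / 2)
    (by norm_num) (by have : (0 : ℝ) ≤ (2 * m + 1 : ℕ) := Nat.cast_nonneg _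
                      linarith) (by norm_num)
  have h3 : ∀ t : ℝ, t * ((t ^ 2 / 2) ^ m * Real.exp (-(1 / 2) * t ^ 2)) =
      (1 / 2) ^ m * (t ^ ((2 * m + 1 : ℕ) : ℝ) * Real.exp (-(1 / 2) * t ^ (2 : ℝ))) := by
    intro t
    rw [Real.rpow_natCast, Real.rpow_two, pow_succ t (2 * m), pow_mul, div_eq_mul_one_div, mul_pow]
    ring
  simp_rw [h3]
  rw [integral_const_mul, h2]
  have h4 : (((2 * m + 1 : ℕ) : ℝ) + 1) / 2 = m + 1 := by push_cast; ring
  rw [neg_div, h4, Real.Gamma_nat_eq_factorial, Real.rpow_neg (by norm_num), Real.rpow_add_one (by norm_num),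
    Real.rpow_natCast]
  have : ((1 : ℝ) / 2) ^ m ≠ 0 := by positivity
  field_simp

/-- Integration against the exponential law, written in the variable `t ^ 2 / 2`. -/
def exponentialFunctional : ℝ[X] →ₗ[ℝ] ℝ where
  toFun p := 1 / 2 * ∫ t : ℝ, |t| * (p.eval (t ^ 2 / 2) * Real.exp (-(1 / 2) * t ^ 2))
  map_add' p q := by
    have h : ∀ p : ℝ[X], Integrable fun t : ℝ =>
        |t| * (p.eval (t ^ 2 / 2) * Real.exp (-(1 / 2) * t ^ 2)) := by
      intro p
      have := integrable_abs_mul_eval_mul_gaussian (b := 1 / 2) (by norm_num)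
        (p.comp (C (1 / 2) * X ^ 2))
      refine this.congr (Filter.Eventually.of_forall fun t => ?_)
      simp only [eval_comp, eval_mul, eval_C, eval_pow, eval_X]
      rw [one_div_mul_eq_div]
    rw [← mul_add, ← integral_add (h p) (h q)]
    simp [add_mul, mul_add]
  map_smul' a p := by
    rw [RingHom.id_apply, smul_eq_mul, mul_left_comm, ← integral_const_mul a]
    congr 1
    refine integral_congr_ae (Filter.Eventually.of_forall fun t => ?_)
    simp
    ring

lemma exponentialFunctional_apply (p : ℝ[X]) : exponentialFunctional p =
    1 / 2 * ∫ t : ℝ, |t| * (p.eval (t ^ 2 / 2) * Real.exp (-(1 / 2) * t ^ 2)) := rfl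

lemma exponentialFunctional_X_pow (m : ℕ) : exponentialFunctional (X ^ m) = m.factorial := by
  rw [exponentialFunctional_apply]
  simp only [eval_pow, eval_X]
  rw [integral_abs_mul_sq_pow_mul_gaussian]
  ring

lemma integral_laguerrePoly_mul_laguerrePoly (j k : ℕ) :
    ∫ t : ℝ, |t| * ((laguerrePoly ℝ j).eval (t ^ 2 / 2) * (laguerrePoly ℝ k).eval (t ^ 2 / 2) *
      Real.exp (-(1 / 2) * t ^ 2)) = if j = k then 2 else 0 := by
  have h := functional_laguerrePoly_mul_laguerrePoly _ exponentialFunctional_X_pow j k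
  rw [exponentialFunctional_apply] at h
  simp only [eval_mul] at h
  split_ifs at h ⊢ <;> linarith

end LaguerreIntegral

/-! ### Regularity and boundedness of the pattern functions -/

section Pattern

open Polynomial

lemma exists_laguerre_eq_eval (n a : ℕ) : ∃ p : ℝ[X], ∀ x, laguerre n a x = p.eval x := by
  refine ⟨∑ i ∈ Finset.range (n + 1),
    C ((-1) ^ i * ((n + a).choose (n - i) : ℝ) / (i.factorial : ℝ)) * X ^ i, fun x => ?_⟩
  rw [laguerre, eval_finsetSum]
  refine Finset.sum_congr rfl fun i _ => ?_
  simp only [eval_mul, eval_C, eval_pow, eval_X]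
  ring

/-- The role of `η > 1/2`: the decay `e^{-t²/4}` beats the deconvolution factor `e^{γt²}`. -/
lemma gam_lt {η : ℝ} (hη : 1 / 2 < η) : gam η < 1 / 4 := by
  rw [gam, div_lt_div_iff₀ (by linarith) (by norm_num)]
  linarith

lemma integrable_patternFourier {η : ℝ} (hη : 1 / 2 < η) (j k : ℕ) :
    Integrable fun t : ℝ => patternFourier j k t * ((Real.exp (gam η * t ^ 2) : ℝ) : ℂ) := by
  obtain ⟨p, hp⟩ := exists_laguerre_eq_eval (min j k) (max j k - min j k)
  have h1 := ((integrable_abs_mul_eval_mul_gaussian (b := 1 / 4 - gam η)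
    (by linarith [gam_lt hη]) (X ^ (max j k - min j k) * p.comp (C (1 / 2) * X ^ 2))).const_mul
      (√(((min j k).factorial : ℝ) /
        (2 ^ (max j k - min j k) * ((max j k).factorial : ℝ))))).ofReal (𝕜 := ℂ)
  refine (h1.const_mul ((Real.pi : ℂ) * (-Complex.I) ^ (max j k - min j k))).congr
    (Filter.Eventually.of_forall fun t => ?_)
  simp only [patternFourier, hp, eval_comp, eval_mul, eval_C, eval_pow, eval_X,
    one_div_mul_eq_div]
  rw [mul_assoc _ _ ((Real.exp (gam η * t ^ 2) : ℝ) : ℂ)]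
  congr 1
  rw [RCLike.ofReal_eq_complex_ofReal, ← Complex.ofReal_mul, Complex.ofReal_inj,
    show -(1 / 4 - gam η) * t ^ 2 = -t ^ 2 / 4 + gam η * t ^ 2 by ring, Real.exp_add]
  ring

lemma continuous_patternFn {η : ℝ} (hη : 1 / 2 < η) (j k : ℕ) : Continuous (patternFn η j k) := by
  refine continuous_const.mul ?_
  refine continuous_of_dominated (bound := fun t =>
    ‖patternFourier j k t * ((Real.exp (gam η * t ^ 2) : ℝ) : ℂ)‖) (fun x => ?_) (fun x => ?_)
    (integrable_patternFourier hη j k).norm (Filter.Eventually.of_forall fun t => by fun_prop)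
  · exact (Continuous.aestronglyMeasurable (by fun_prop)).mul
      (integrable_patternFourier hη j k).aestronglyMeasurable
  · refine Filter.Eventually.of_forall fun t => ?_
    rw [norm_mul, mul_comm Complex.I, Complex.norm_exp_ofReal_mul_I, one_mul]

/-- An unbounded real supremum would default to `0`, so a bound is exhibited: the `L¹` norm of the
Fourier transform, up to `1/(2π)`. -/
lemma norm_patternFn_le_supNorm (η : ℝ) (j k : ℕ) (x : ℝ) :
    ‖patternFn η j k x‖ ≤ supNorm (patternFn η j k) := by
  refine le_ciSup (f := fun x => ‖patternFn η j k x‖)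
    ⟨‖(1 / ((2 * Real.pi : ℝ) : ℂ))‖ * ∫ t : ℝ,
    ‖patternFourier j k t * ((Real.exp (gam η * t ^ 2) : ℝ) : ℂ)‖, ?_⟩ x
  rintro _ ⟨x, rfl⟩
  simp only [patternFn]
  rw [norm_mul]
  refine mul_le_mul_of_nonneg_left ?_ (norm_nonneg _)
  refine (norm_integral_le_integral_norm _).trans_eq ?_
  refine integral_congr_ae (Filter.Eventually.of_forall fun t => ?_)
  simp only
  rw [norm_mul, mul_comm Complex.I, Complex.norm_exp_ofReal_mul_I, one_mul]

lemma supNorm_patternFn_nonneg (η : ℝ) (j k : ℕ) : 0 ≤ supNorm (patternFn η j k) :=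
  Real.iSup_nonneg fun _ => norm_nonneg _

lemma continuous_kernelG_div {η : ℝ} (hη : 1 / 2 < η) (j k : ℕ) :
    Continuous fun z : ℝ × ℝ => kernelG η j k (z.1 / √η) z.2 := by
  have := continuous_patternFn hη j k
  unfold kernelG
  fun_prop

lemma norm_kernelG_le (η : ℝ) (j k : ℕ) (x φ : ℝ) :
    ‖kernelG η j k x φ‖ ≤ supNorm (patternFn η j k) := by
  rw [kernelG, norm_mul, ← mul_neg, ← Complex.ofReal_neg, mul_comm Complex.I,
    Complex.norm_exp_ofReal_mul_I, mul_one]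
  exact norm_patternFn_le_supNorm η j k x

/-- The mean of an adapted pattern function in terms of a characteristic function. -/
lemma integral_patternFn {η : ℝ} (hη : 1 / 2 < η) (j k : ℕ) (ν : Measure ℝ)
    [IsProbabilityMeasure ν] :
    ∫ x, patternFn η j k x ∂ν = 1 / ((2 * Real.pi : ℝ) : ℂ) *
      ∫ t : ℝ, charFun ν t * (patternFourier j k t * ((Real.exp (gam η * t ^ 2) : ℝ) : ℂ)) := by
  simp only [patternFn]
  rw [integral_const_mul, integral_integral_swap]
  · congr 2
    ext t
    rw [integral_mul_const, charFun_apply_real]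
    congr 2
    ext x
    congr 1
    push_cast; ring
  · have h := (integrable_patternFourier hη j k).comp_snd ν
    refine h.bdd_mul (c := 1) (Continuous.aestronglyMeasurable (by fun_prop))
      (Filter.Eventually.of_forall fun z => ?_)
    rw [mul_comm Complex.I, Complex.norm_exp_ofReal_mul_I]

end Pattern

/-! ### Law of the measurements and unbiasedness -/

section Law

open Polynomial

/-- The law of a quadrature of a Fock state. -/
def fockLaw (n : ℕ) : Measure ℝ :=
  volume.withDensity fun x => ENNReal.ofReal (fockBasis n x ^ 2)

/-- The law of the phase, uniform on `[0, π]`. -/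
def phaseLaw : Measure ℝ :=
  (volume.restrict (Set.Icc 0 Real.pi)).withDensity fun _ => ENNReal.ofReal (1 / Real.pi)

lemma idealLaw_fockState (n : ℕ) : idealLaw (fockState n) = (fockLaw n).prod phaseLaw := by
  have h := continuous_fockBasis n
  rw [idealLaw, fockLaw, phaseLaw, prod_withDensity (by fun_prop) (by fun_prop),
    Measure.volume_eq_prod, ← Measure.prod_restrict, Measure.restrict_univ]
  congr 1
  ext z
  rw [quadratureDensity_fockState, div_eq_mul_one_div, ENNReal.ofReal_mul (by positivity)]

lemma integral_fockLaw (n : ℕ) (f : ℝ → ℂ) :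
    ∫ x, f x ∂(fockLaw n) = ∫ x, ((fockBasis n x ^ 2 : ℝ) : ℂ) * f x := by
  have h := continuous_fockBasis n
  rw [fockLaw, integral_withDensity_eq_integral_toReal_smul (by fun_prop)
    (Filter.Eventually.of_forall fun _ => ENNReal.ofReal_lt_top)]
  refine integral_congr_ae (Filter.Eventually.of_forall fun x => ?_)
  simp only
  rw [ENNReal.toReal_ofReal (by positivity), Complex.real_smul]

lemma charFun_fockLaw (n : ℕ) (t : ℝ) : charFun (fockLaw n) t =
    ((Real.exp (-t ^ 2 / 4) * (laguerrePoly ℝ n).eval (t ^ 2 / 2) : ℝ) : ℂ) := by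
  have h := integral_fockBasis_position n t 0
  simp only [zero_div, sub_zero, add_zero, zero_pow two_ne_zero] at h
  rw [charFun_apply_real, integral_fockLaw, ← h]
  refine integral_congr_ae (Filter.Eventually.of_forall fun x => ?_)
  simp only
  rw [pow_two]
  congr 2
  push_cast; ring

lemma integral_fockBasis_sq (n : ℕ) : ∫ x : ℝ, fockBasis n x ^ 2 = 1 := by
  have h := integral_fockBasis_position n 0 0
  simp only [zero_div, sub_zero, add_zero, zero_mul, Complex.ofReal_zero, mul_zero,
    Complex.exp_zero, mul_one, zero_pow two_ne_zero, neg_zero, Real.exp_zero, one_mul] at h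
  rw [integral_complex_ofReal, Complex.ofReal_inj] at h
  simp_rw [pow_two]
  rw [h, eval_laguerrePoly, Finset.sum_eq_single 0]
  · simp
  · intro i _ hi; simp [hi]
  · simp

instance (n : ℕ) : IsProbabilityMeasure (fockLaw n) := by
  constructor
  have h := (integrable_fockBasis_mul n 0)
  simp only [zero_div, sub_zero, add_zero, ← pow_two] at h
  rw [fockLaw, withDensity_apply _ MeasurableSet.univ, Measure.restrict_univ,
    ← ofReal_integral_eq_lintegral_ofReal h (Filter.Eventually.of_forall fun x => by positivity),
    integral_fockBasis_sq, ENNReal.ofReal_one]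

instance : IsProbabilityMeasure phaseLaw := by
  constructor
  rw [phaseLaw, withDensity_apply _ MeasurableSet.univ, Measure.restrict_univ, lintegral_const,
    Measure.restrict_apply MeasurableSet.univ, Set.univ_inter, Real.volume_Icc, sub_zero,
    ← ENNReal.ofReal_mul (by positivity), one_div_mul_cancel Real.pi_ne_zero, ENNReal.ofReal_one]

lemma integral_phaseLaw (f : ℝ → ℂ) :
    ∫ φ, f φ ∂phaseLaw = 1 / Real.pi * ∫ φ in (0 : ℝ)..Real.pi, f φ := by
  rw [phaseLaw, integral_withDensity_eq_integral_toReal_smul (by fun_prop)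
    (Filter.Eventually.of_forall fun _ => ENNReal.ofReal_lt_top),
    intervalIntegral.integral_of_le Real.pi_pos.le, ← integral_Icc_eq_integral_Ioc]
  simp only [ENNReal.toReal_ofReal (show 0 ≤ 1 / Real.pi by positivity), Complex.real_smul]
  rw [integral_const_mul]
  push_cast
  rfl

/-- The mean phase factor of an entry of the density matrix. -/
def phaseMean (j k : ℕ) : ℂ :=
  ∫ φ, Complex.exp (-(Complex.I * ((((j : ℝ) - (k : ℝ)) * φ : ℝ) : ℂ))) ∂phaseLaw

lemma phaseMean_self (j : ℕ) : phaseMean j j = 1 := by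
  simp [phaseMean]

/-- Over `[0, π]` only even nonzero frequencies complete whole periods; odd gaps need the parity
argument of `integral_patternFourier_of_odd`. -/
lemma phaseMean_of_even {j k m : ℕ} (hm : m ≠ 0) (h : j = k + 2 * m ∨ k = j + 2 * m) :
    phaseMean j k = 0 := by
  obtain ⟨l, hl0, hl⟩ : ∃ l : ℤ, l ≠ 0 ∧ (j : ℝ) - k = 2 * l := by
    rcases h with h | h
    · exact ⟨m, by exact_mod_cast hm, by rw [h]; push_cast; ring⟩
    · exact ⟨-m, by simpa using hm, by rw [h]; push_cast; ring⟩
  have hc : (-(Complex.I * (2 * l))) ≠ 0 := by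
    simp [hl0]
  rw [phaseMean, integral_phaseLaw]
  have h1 : ∀ φ : ℝ, Complex.exp (-(Complex.I * ((((j : ℝ) - (k : ℝ)) * φ : ℝ) : ℂ))) =
      Complex.exp (-(Complex.I * (2 * l)) * φ) := by
    intro φ
    rw [hl]
    congr 1
    push_cast; ring
  simp_rw [h1]
  rw [integral_exp_mul_complex hc]
  have h2 : Complex.exp (-(Complex.I * (2 * l)) * Real.pi) = 1 := by
    rw [Complex.exp_eq_one_iff]
    exact ⟨-l, by push_cast; ring⟩
  rw [h2]
  simp

/-- The law of a rescaled noisy quadrature. -/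
def noisyQuadrature (η : ℝ) (n : ℕ) : Measure ℝ :=
  ((fockLaw n).prod (gaussianReal 0 1)).map fun z => z.1 + √((1 - η) / 2) / √η * z.2

instance (η : ℝ) (n : ℕ) : IsProbabilityMeasure (noisyQuadrature η n) :=
  Measure.isProbabilityMeasure_map (by fun_prop)

lemma charFun_noisyQuadrature {η : ℝ} (hη : 0 < η) (hη1 : η ≤ 1) (n : ℕ) (t : ℝ) :
    charFun (noisyQuadrature η n) t =
      ((Real.exp (-t ^ 2 / 4) * (laguerrePoly ℝ n).eval (t ^ 2 / 2) *
        Real.exp (-(gam η * t ^ 2)) : ℝ) : ℂ) := by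
  rw [charFun_apply_real, noisyQuadrature, integral_map (by fun_prop)
    (Continuous.aestronglyMeasurable (by fun_prop))]
  have h : ∀ z : ℝ × ℝ, Complex.exp (t * ((z.1 + √((1 - η) / 2) / √η * z.2 : ℝ) : ℂ) * Complex.I) =
      Complex.exp (t * z.1 * Complex.I) *
        Complex.exp (((t * (√((1 - η) / 2) / √η) : ℝ) : ℂ) * z.2 * Complex.I) := by
    intro z
    rw [← Complex.exp_add]
    congr 1
    push_cast; ring
  simp_rw [h]
  rw [integral_prod_mul (fun x : ℝ => Complex.exp (t * x * Complex.I))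
    (fun y : ℝ => Complex.exp (((t * (√((1 - η) / 2) / √η) : ℝ) : ℂ) * y * Complex.I)),
    ← charFun_apply_real, ← charFun_apply_real, charFun_fockLaw, charFun_gaussianReal,
    Complex.ofReal_mul _ (Real.exp (-(gam η * t ^ 2))), Complex.ofReal_exp (-(gam η * t ^ 2))]
  congr 2
  have h1 : √((1 - η) / 2) ^ 2 = (1 - η) / 2 := Real.sq_sqrt (by linarith)
  have h2 : √η ^ 2 = η := Real.sq_sqrt hη.le
  -- The rescaled noise has variance `(1 - η)/(2η) = 2γ`.
  have h3 : (t * (√((1 - η) / 2) / √η)) ^ 2 / 2 = gam η * t ^ 2 := by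
    rw [gam, mul_pow, div_pow, h1, h2]
    field_simp
    ring
  rw [← h3]
  push_cast
  ring

lemma integral_kernelG_noisyLaw {η : ℝ} (hη : 1 / 2 < η) (n j k : ℕ) :
    ∫ z, kernelG η j k (z.1 / √η) z.2 ∂(noisyLaw η (fockState n)) =
      (∫ x, patternFn η j k x ∂(noisyQuadrature η n)) * phaseMean j k := by
  have hp := continuous_patternFn hη j k
  have hk : Continuous fun z : ℝ × ℝ => kernelG η j k (z.1 / √η) z.2 :=
      continuous_kernelG_div hη j k
  have hs : √η ≠ 0 := (Real.sqrt_pos.2 (by linarith)).ne'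
  rw [noisyLaw, idealLaw_fockState, integral_map (by fun_prop) hk.aestronglyMeasurable]
  have h : ∀ z : (ℝ × ℝ) × ℝ,
      kernelG η j k ((√η * z.1.1 + √((1 - η) / 2) * z.2) / √η) z.1.2 =
        patternFn η j k (z.1.1 + √((1 - η) / 2) / √η * z.2) *
          Complex.exp (-(Complex.I * ((((j : ℝ) - (k : ℝ)) * z.1.2 : ℝ) : ℂ))) := by
    intro z
    have hz : (√η * z.1.1 + √((1 - η) / 2) * z.2) / √η =
        z.1.1 + √((1 - η) / 2) / √η * z.2 := by
      rw [add_div, mul_div_cancel_left₀ _ hs, mul_div_right_comm]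
    rw [kernelG, hz]
  simp_rw [h]
  have hint : Integrable (fun z : (ℝ × ℝ) × ℝ =>
      patternFn η j k (z.1.1 + √((1 - η) / 2) / √η * z.2) *
          Complex.exp (-(Complex.I * ((((j : ℝ) - (k : ℝ)) * z.1.2 : ℝ) : ℂ))))
      (((fockLaw n).prod phaseLaw).prod (gaussianReal 0 1)) := by
    refine Integrable.of_bound (Continuous.aestronglyMeasurable (by fun_prop))
      (supNorm (patternFn η j k)) (Filter.Eventually.of_forall fun z => ?_)
    rw [← h]
    exact norm_kernelG_le η j k _ _
  rw [integral_prod _ hint]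
  simp only [integral_mul_const]
  rw [integral_prod_mul (fun x : ℝ => ∫ y, patternFn η j k (x + √((1 - η) / 2) / √η * y)
    ∂(gaussianReal 0 1)) (fun φ : ℝ =>
      Complex.exp (-(Complex.I * ((((j : ℝ) - (k : ℝ)) * φ : ℝ) : ℂ)))),
    noisyQuadrature, integral_map (by fun_prop) hp.aestronglyMeasurable, integral_prod]
  · rfl
  · exact Integrable.of_bound (Continuous.aestronglyMeasurable (by fun_prop))
      (supNorm (patternFn η j k)) (Filter.Eventually.of_forall fun z =>
        norm_patternFn_le_supNorm η j k _)

lemma integral_patternFn_noisyQuadrature {η : ℝ} (hη : 1 / 2 < η) (hη1 : η ≤ 1) (n j k : ℕ) :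
    ∫ x, patternFn η j k x ∂(noisyQuadrature η n) = 1 / ((2 * Real.pi : ℝ) : ℂ) *
      ∫ t : ℝ, patternFourier j k t *
        ((Real.exp (-t ^ 2 / 4) * (laguerrePoly ℝ n).eval (t ^ 2 / 2) : ℝ) : ℂ) := by
  rw [integral_patternFn hη]
  congr 1
  refine integral_congr_ae (Filter.Eventually.of_forall fun t => ?_)
  simp only
  rw [charFun_noisyQuadrature (by linarith) hη1, Complex.ofReal_mul _ (Real.exp (-(gam η * t ^ 2)))]
  have h : ((Real.exp (-(gam η * t ^ 2)) : ℝ) : ℂ) * ((Real.exp (gam η * t ^ 2) : ℝ) : ℂ) = 1 := by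
    rw [← Complex.ofReal_mul, ← Real.exp_add]
    simp
  linear_combination (((Real.exp (-t ^ 2 / 4) * (laguerrePoly ℝ n).eval (t ^ 2 / 2) : ℝ) : ℂ) *
    patternFourier j k t) * h

lemma integral_patternFourier_of_odd {j k : ℕ} (h : Odd (max j k - min j k)) (n : ℕ) :
    ∫ t : ℝ, patternFourier j k t *
      ((Real.exp (-t ^ 2 / 4) * (laguerrePoly ℝ n).eval (t ^ 2 / 2) : ℝ) : ℂ) = 0 := by
  have h1 := integral_neg_eq_self (fun t : ℝ => patternFourier j k t *
      ((Real.exp (-t ^ 2 / 4) * (laguerrePoly ℝ n).eval (t ^ 2 / 2) : ℝ) : ℂ)) volume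
  have h2 : ∀ t : ℝ, patternFourier j k (-t) = -patternFourier j k t := by
    intro t
    simp only [patternFourier, abs_neg, h.neg_pow, neg_sq]
    push_cast
    ring
  simp only [h2, neg_sq, neg_mul, integral_neg] at h1
  exact self_eq_neg.1 h1.symm

lemma integral_patternFourier_self (j n : ℕ) :
    ∫ t : ℝ, patternFourier j j t *
      ((Real.exp (-t ^ 2 / 4) * (laguerrePoly ℝ n).eval (t ^ 2 / 2) : ℝ) : ℂ) =
        if j = n then ((2 * Real.pi : ℝ) : ℂ) else 0 := by
  have h : ∀ t : ℝ, patternFourier j j t *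
      ((Real.exp (-t ^ 2 / 4) * (laguerrePoly ℝ n).eval (t ^ 2 / 2) : ℝ) : ℂ) =
      ((Real.pi * (|t| * ((laguerrePoly ℝ j).eval (t ^ 2 / 2) * (laguerrePoly ℝ n).eval (t ^ 2 / 2) *
      Real.exp (-(1 / 2) * t ^ 2))) : ℝ) : ℂ) := by
    intro t
    have hf : (j.factorial : ℝ) ≠ 0 := by exact_mod_cast j.factorial_ne_zero
    simp only [patternFourier, max_self, min_self, Nat.sub_self, pow_zero, one_mul, mul_one,
      div_self hf, Real.sqrt_one, laguerre_zero_order]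
    rw [show -(1 / 2) * t ^ 2 = -t ^ 2 / 4 + -t ^ 2 / 4 by ring, Real.exp_add]
    push_cast
    ring
  simp_rw [h]
  rw [integral_complex_ofReal, integral_const_mul, integral_laguerrePoly_mul_laguerrePoly]
  split_ifs
  · rw [mul_comm]
  · simp

/-- The pattern functions give unbiased estimators of the density matrix of a Fock state. -/
theorem integral_kernelG_noisyLaw_eq_fockState {η : ℝ} (hη : 1 / 2 < η) (hη1 : η ≤ 1)
    (n j k : ℕ) :
    ∫ z, kernelG η j k (z.1 / √η) z.2 ∂(noisyLaw η (fockState n)) = fockState n j k := by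
  rw [integral_kernelG_noisyLaw hη, integral_patternFn_noisyQuadrature hη hη1]
  rcases eq_or_ne j k with rfl | hjk
  · rw [phaseMean_self, integral_patternFourier_self, fockState]
    have : ((2 * Real.pi : ℝ) : ℂ) ≠ 0 := by
      exact_mod_cast (by positivity : (2 * Real.pi : ℝ) ≠ 0)
    by_cases hj : j = n
    · simp only [hj, and_self, if_true, mul_one]
      exact one_div_mul_cancel this
    · simp [hj]
  · have h0 : fockState n j k = 0 := by
      rw [fockState, if_neg]
      rintro ⟨rfl, rfl⟩
      exact hjk rfl
    rw [h0]
    rcases Nat.even_or_odd (max j k - min j k) with he | ho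
    · obtain ⟨m, hm⟩ := he
      rw [phaseMean_of_even (m := m) (by omega) (by omega), mul_zero]
    · rw [integral_patternFourier_of_odd ho]
      simp

end Law

/-! ### Hoeffding bounds -/

section Concentration

variable {Ω : Type*} [MeasurableSpace Ω] {P : Measure Ω} [IsProbabilityMeasure P]

/-- Each centred variable is sub-Gaussian with variance proxy `B²`; the deviation level is chosen so
that the exponent is exactly `-L`. -/
lemma measureReal_sum_sub_ge_le {n : ℕ} (hn : n ≠ 0) {U : Fin n → Ω → ℝ}
    (hU : ∀ l, AEMeasurable (U l) P) (hind : iIndepFun U P) {B : ℝ} (hB : 0 < B)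
    (hbd : ∀ l ω, |U l ω| ≤ B) {m : ℝ} (hm : ∀ l, P[U l] = m) {L : ℝ} (hL : 0 ≤ L) :
    P.real {ω | n * (B * √(2 * L / n)) ≤ ∑ l, (U l ω - m)} ≤ Real.exp (-L) := by
  have hsub : ∀ l ∈ Finset.univ, HasSubgaussianMGF (fun ω => U l ω - m)
      ((‖B - -B‖₊ / 2) ^ 2) P := by
    intro l _
    have := hasSubgaussianMGF_of_mem_Icc (μ := P) (X := U l) (a := -B) (b := B) (hU l)
      (Filter.Eventually.of_forall fun ω => abs_le.1 (hbd l ω))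
    rwa [hm l] at this
  have hind' : iIndepFun (fun l ω => U l ω - m) P :=
    hind.comp (fun _ x => x - m) (fun _ => by fun_prop)
  have hn' : (0 : ℝ) < n := by exact_mod_cast Nat.pos_of_ne_zero hn
  refine (HasSubgaussianMGF.measure_sum_ge_le_of_iIndepFun hind' hsub (by positivity)).trans_eq ?_
  congr 1
  have h1 : ((∑ _l : Fin n, (‖B - -B‖₊ / 2) ^ 2 : NNReal) : ℝ) = n * B ^ 2 := by
    simp only [Finset.sum_const, Finset.card_univ, Fintype.card_fin, nsmul_eq_mul]
    push_cast
    rw [Real.norm_of_nonneg (by linarith)]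
    ring
  have h2 : √(2 * L / n) ^ 2 = 2 * L / n := Real.sq_sqrt (by positivity)
  rw [h1, mul_pow, mul_pow, h2]
  field_simp

/-- Hoeffding's inequality for the empirical mean of bounded independent variables. -/
lemma measureReal_abs_mean_sub_gt_le {n : ℕ} (hn : n ≠ 0) {U : Fin n → Ω → ℝ}
    (hU : ∀ l, AEMeasurable (U l) P) (hind : iIndepFun U P) {B : ℝ}
    (hbd : ∀ l ω, |U l ω| ≤ B) {m : ℝ} (hm : ∀ l, P[U l] = m) {L : ℝ} (hL : 0 ≤ L) :
    P.real {ω | B * √(2 * L / n) < |1 / n * ∑ l, U l ω - m|} ≤ 2 * Real.exp (-L) := by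
  have hn' : (0 : ℝ) < n := by exact_mod_cast Nat.pos_of_ne_zero hn
  rcases le_or_gt B 0 with hB | hB
  · have hU0 : ∀ l ω, U l ω = 0 := fun l ω => abs_nonpos_iff.1 ((hbd l ω).trans hB)
    have hm0 : m = 0 := by
      rw [← hm ⟨0, Nat.pos_of_ne_zero hn⟩]
      simp [hU0]
    have hempty : {ω | B * √(2 * L / n) < |1 / n * ∑ l, U l ω - m|} = ∅ := by
      ext ω
      have hB0 : B = 0 := le_antisymm hB
        ((abs_nonneg _).trans (hbd ⟨0, Nat.pos_of_ne_zero hn⟩ ω))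
      simp [hU0, hm0, hB0]
    rw [hempty]
    simp only [measureReal_empty]
    positivity
  · have h1 := measureReal_sum_sub_ge_le hn hU hind hB hbd hm hL
    have h2 := measureReal_sum_sub_ge_le (U := fun l ω => -U l ω) (m := -m) hn
      (fun l => (hU l).neg) (hind.comp (fun _ x => -x) (fun _ => by fun_prop)) hB
      (fun l ω => by rw [abs_neg]; exact hbd l ω)
      (fun l => by rw [integral_neg, hm l]) hL
    have hsubset : {ω | B * √(2 * L / n) < |1 / n * ∑ l, U l ω - m|} ⊆
        {ω | n * (B * √(2 * L / n)) ≤ ∑ l, (U l ω - m)} ∪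
        {ω | n * (B * √(2 * L / n)) ≤ ∑ l, (-U l ω - -m)} := by
      intro ω hω
      simp only [Set.mem_ofPred_eq, Set.mem_union, Finset.sum_sub_distrib, Finset.sum_const,
        Finset.card_univ, Fintype.card_fin, nsmul_eq_mul, Finset.sum_neg_distrib] at hω ⊢
      have e : ∑ l, U l ω - n * m = n * (1 / n * ∑ l, U l ω - m) := by field_simp
      rcases lt_abs.1 hω with h | h
      · left
        rw [e]
        exact (mul_le_mul_of_nonneg_left h.le hn'.le)
      · right
        rw [show -∑ l, U l ω - n * -m = -(∑ l, U l ω - n * m) by ring, e, ← mul_neg]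
        exact (mul_le_mul_of_nonneg_left h.le hn'.le)
    calc _ ≤ _ := measureReal_mono hsubset
      _ ≤ _ := measureReal_union_le _ _
      _ ≤ _ := by linarith

/-- Hoeffding's inequality for the empirical mean of a bounded complex function. -/
lemma measureReal_norm_mean_sub_gt_le {n : ℕ} (hn : n ≠ 0) {S : Type*} [MeasurableSpace S]
    {Z : Fin n → Ω → S} (hind : iIndepFun Z P) (hZ : ∀ l, AEMeasurable (Z l) P) {g : S → ℂ}
    (hg : Measurable g) {B : ℝ} (hbd : ∀ z, ‖g z‖ ≤ B) {m : ℂ}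
    (hm : ∀ l, ∫ ω, g (Z l ω) ∂P = m) {L : ℝ} (hL : 0 ≤ L) :
    P.real {ω | 2 * B * √(L / n) < ‖1 / (n : ℂ) * ∑ l, g (Z l ω) - m‖} ≤ 4 * Real.exp (-L) := by
  have hint : ∀ l, Integrable (fun ω => g (Z l ω)) P := fun l =>
    Integrable.of_bound ((hg.comp_aemeasurable (hZ l)).aestronglyMeasurable) B
      (Filter.Eventually.of_forall fun ω => hbd _)
  have h1 := measureReal_abs_mean_sub_gt_le (P := P) (U := fun l ω => (g (Z l ω)).re) (B := B)
    (m := m.re) hn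
    (fun l => (Complex.measurable_re.comp hg).comp_aemeasurable (hZ l))
    (hind.comp (fun _ z => (g z).re) (fun _ => Complex.measurable_re.comp hg))
    (fun l ω => (Complex.abs_re_le_norm _).trans (hbd _))
    (fun l => by
      rw [← hm l]
      exact integral_re (hint l)) hL
  have h2 := measureReal_abs_mean_sub_gt_le (P := P) (U := fun l ω => (g (Z l ω)).im) (B := B)
    (m := m.im) hn
    (fun l => (Complex.measurable_im.comp hg).comp_aemeasurable (hZ l))
    (hind.comp (fun _ z => (g z).im) (fun _ => Complex.measurable_im.comp hg))
    (fun l ω => (Complex.abs_im_le_norm _).trans (hbd _))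
    (fun l => by
      rw [← hm l]
      exact integral_im (hint l)) hL
  -- If both parts are at most `B√(2L/n)`, the squared modulus is at most `4B²L/n`.
  have hsubset : {ω | 2 * B * √(L / n) < ‖1 / (n : ℂ) * ∑ l, g (Z l ω) - m‖} ⊆
      {ω | B * √(2 * L / n) < |1 / n * ∑ l, (g (Z l ω)).re - m.re|} ∪
      {ω | B * √(2 * L / n) < |1 / n * ∑ l, (g (Z l ω)).im - m.im|} := by
    intro ω hω
    by_contra hcon
    simp only [Set.mem_union, Set.mem_ofPred_eq, not_or, not_lt] at hcon hω
    have hB : 0 ≤ B := (norm_nonneg _).trans (hbd (Z ⟨0, Nat.pos_of_ne_zero hn⟩ ω))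
    set w := 1 / (n : ℂ) * ∑ l, g (Z l ω) - m with hw
    have e : (1 / (n : ℂ)) = ((1 / n : ℝ) : ℂ) := by push_cast; rfl
    have hre : w.re = 1 / n * ∑ l, (g (Z l ω)).re - m.re := by
      rw [hw, e, Complex.sub_re, Complex.re_ofReal_mul, Complex.re_sum]
    have him : w.im = 1 / n * ∑ l, (g (Z l ω)).im - m.im := by
      rw [hw, e, Complex.sub_im, Complex.im_ofReal_mul, Complex.im_sum]
    rw [← hre, ← him] at hcon
    have h3 : √(2 * L / n) ^ 2 = 2 * L / n := Real.sq_sqrt (by positivity)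
    have h4 : √(L / n) ^ 2 = L / n := Real.sq_sqrt (by positivity)
    have h5 : w.re ^ 2 ≤ B ^ 2 * (2 * L / n) := by
      rw [← h3, ← mul_pow, ← sq_abs w.re]
      exact pow_le_pow_left₀ (abs_nonneg _) hcon.1 2
    have h6 : w.im ^ 2 ≤ B ^ 2 * (2 * L / n) := by
      rw [← h3, ← mul_pow, ← sq_abs w.im]
      exact pow_le_pow_left₀ (abs_nonneg _) hcon.2 2
    have h7 : ‖w‖ ^ 2 ≤ (2 * B * √(L / n)) ^ 2 := by
      rw [← Complex.normSq_eq_norm_sq, Complex.normSq_apply, mul_pow, h4]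
      calc w.re * w.re + w.im * w.im = w.re ^ 2 + w.im ^ 2 := by ring
        _ ≤ B ^ 2 * (2 * L / n) + B ^ 2 * (2 * L / n) := add_le_add h5 h6
        _ = _ := by ring
    exact absurd (abs_le_of_sq_le_sq h7 (by positivity)) (by rw [abs_norm]; exact not_le.2 hω)
  calc _ ≤ _ := measureReal_mono hsubset
    _ ≤ _ := measureReal_union_le _ _
    _ ≤ _ := by linarith

end Concentration

/-! ### Soft thresholding -/

section Threshold

/-- Soft thresholding of a complex number. -/
def softThreshold (t : ℝ) (z : ℂ) : ℂ :=
  z / ((‖z‖ : ℝ) : ℂ) * ((max (‖z‖ - t) 0 : ℝ) : ℂ)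

lemma softThreshold_of_norm_le {t : ℝ} {z : ℂ} (h : ‖z‖ ≤ t) : softThreshold t z = 0 := by
  rw [softThreshold, max_eq_right (by linarith)]
  simp

lemma norm_softThreshold_sub_self_le {t : ℝ} (ht : 0 ≤ t) (z : ℂ) :
    ‖softThreshold t z - z‖ ≤ t := by
  rcases le_or_gt ‖z‖ t with h | h
  · rw [softThreshold_of_norm_le h, zero_sub, norm_neg]
    exact h
  · have hz : 0 < ‖z‖ := ht.trans_lt h
    have hz' : ((‖z‖ : ℝ) : ℂ) ≠ 0 := by exact_mod_cast hz.ne'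
    have e : softThreshold t z - z = -(z / ((‖z‖ : ℝ) : ℂ) * (t : ℂ)) := by
      rw [softThreshold, max_eq_left (by linarith)]
      push_cast
      field_simp
      ring
    rw [e, norm_neg, norm_mul, norm_div, Complex.norm_real, norm_norm, div_self hz.ne', one_mul,
      Complex.norm_real, Real.norm_of_nonneg ht]

lemma rhoTilde_eq_softThreshold {n : ℕ} (η : ℝ) (N : ℕ) (ε : ℝ) (y φ : Fin n → ℝ) (j k : ℕ) :
    rhoTilde η N ε y φ j k = softThreshold (threshold n η N ε j k) (rhoHat η N y φ j k) := rfl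

lemma threshold_nonneg (n : ℕ) (η : ℝ) (N : ℕ) (ε : ℝ) (j k : ℕ) : 0 ≤ threshold n η N ε j k :=
  mul_nonneg (mul_nonneg two_pos.le (supNorm_patternFn_nonneg η j k)) (Real.sqrt_nonneg _)

/-- Only `(j₀, j₀)` survives, and `2 * j₀ < N` keeps it in the estimated range. Shrinkage and
estimation each cost one threshold there. -/
lemma l2Norm_rhoTilde_sub_fockState_sq_le {n : ℕ} {η : ℝ} {N : ℕ} {ε : ℝ} {y φ : Fin n → ℝ}
    {j₀ : ℕ} (hN : 2 * j₀ < N) (h : ∀ j k, j + k < N →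
      ‖rhoHat η N y φ j k - fockState j₀ j k‖ ≤ threshold n η N ε j k) :
    l2Norm (fun j k => rhoTilde η N ε y φ j k - fockState j₀ j k) ^ 2 ≤
      (2 * threshold n η N ε j₀ j₀) ^ 2 := by
  have hzero : ∀ p : ℕ × ℕ, p ≠ (j₀, j₀) →
      ‖rhoTilde η N ε y φ p.1 p.2 - fockState j₀ p.1 p.2‖ ^ 2 = 0 := by
    rintro ⟨j, k⟩ hp
    have h0 : fockState j₀ j k = 0 := by
      rw [fockState, if_neg]
      rintro ⟨rfl, rfl⟩
      exact hp rfl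
    simp only
    rw [h0, sub_zero, rhoTilde_eq_softThreshold, softThreshold_of_norm_le]
    · simp
    · by_cases hjk : j + k < N
      · simpa [h0] using h j k hjk
      · rw [rhoHat, if_neg hjk, norm_zero]
        exact threshold_nonneg _ _ _ _ _ _
  rw [l2Norm, tsum_eq_single (j₀, j₀) hzero, Real.sqrt_sq (norm_nonneg _)]
  refine pow_le_pow_left₀ (norm_nonneg _) ?_ 2
  have h1 := norm_softThreshold_sub_self_le (threshold_nonneg n η N ε j₀ j₀)
    (rhoHat η N y φ j₀ j₀)
  have h2 := h j₀ j₀ (by omega)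
  rw [rhoTilde_eq_softThreshold, two_mul]
  exact (norm_sub_le_norm_sub_add_norm_sub _ _ _).trans (add_le_add h1 h2)

end Threshold

/-! ### The logarithmic factor -/

section Tuning

/-- With `A = log n / (2B₀)`, one has `2N(N+1)/ε < (4N/ε)²` and `N ≤ A^{2/r₀}`. Since `2/r₀ > 1`,
`log(4/ε)` can take the same factor as `log A`, and `4A/ε` is the target argument. -/
lemma log_le_of_lt_tuningN {B₀ r₀ ε : ℝ} {n : ℕ} (hB₀ : 0 < B₀) (hr₀ : 0 < r₀) (hr₀2 : r₀ < 2)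
    (hε : 0 < ε) (hε1 : ε < 1) (hN : 2 < tuningN B₀ r₀ n) :
    Real.log (2 * (tuningN B₀ r₀ n : ℝ) * ((tuningN B₀ r₀ n : ℝ) + 1) / ε) <
      4 / r₀ * Real.log (2 * Real.log n / (B₀ * ε)) := by
  set N := tuningN B₀ r₀ n with hNdef
  set A := Real.log n / (2 * B₀) with hA
  have hN2 : (2 : ℝ) < N := by exact_mod_cast hN
  have hA0 : 0 ≤ A := div_nonneg (Real.log_natCast_nonneg n) (by linarith)
  have hle : (N : ℝ) ≤ A ^ (2 / r₀) := Nat.floor_le (Real.rpow_nonneg hA0 _)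
  have hc : 1 < 2 / r₀ := by rwa [one_lt_div hr₀]
  have hApos : 0 < A := by
    rcases hA0.lt_or_eq with h | h
    · exact h
    · rw [← h, Real.zero_rpow (by linarith)] at hle
      linarith
  have h1 : Real.log N ≤ 2 / r₀ * Real.log A := by
    rw [← Real.log_rpow hApos]
    exact Real.log_le_log (by linarith) hle
  have h4 : 1 < 4 / ε := by rw [one_lt_div hε]; linarith
  have h2 : Real.log (4 / ε) ≤ 2 / r₀ * Real.log (4 / ε) :=
    le_mul_of_one_le_left (Real.log_nonneg h4.le) hc.le
  have h3 : 2 * Real.log n / (B₀ * ε) = 4 / ε * A := by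
    rw [hA]
    field_simp
    ring
  rw [h3, Real.log_mul (by positivity) hApos.ne']
  have h5 : Real.log (2 * (N : ℝ) * (N + 1) / ε) < Real.log ((4 / ε * N) ^ 2) := by
    refine Real.log_lt_log (by positivity) ?_
    rw [mul_pow, div_pow, div_mul_eq_mul_div, div_lt_div_iff₀ hε (by positivity)]
    have : 2 * (N : ℝ) * (N + 1) * ε < 4 ^ 2 * N ^ 2 := by nlinarith
    nlinarith
  rw [Real.log_pow, Real.log_mul (by positivity) (by linarith)] at h5
  push_cast at h5
  calc _ < _ := h5
    _ ≤ 2 * (2 / r₀ * Real.log (4 / ε) + 2 / r₀ * Real.log A) := by linarith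
    _ = _ := by ring

lemma ne_zero_of_lt_tuningN {B₀ r₀ : ℝ} {n : ℕ} (hr₀ : 0 < r₀) (hN : 2 < tuningN B₀ r₀ n) :
    n ≠ 0 := by
  rintro rfl
  have : (2 / r₀) ≠ 0 := by positivity
  simp [tuningN, Real.zero_rpow this] at hN

end Tuning

/-- Needed for the strict final inequality: a zero kernel could not have mean `1` under the state
`j`. -/
lemma supNorm_patternFn_self_pos {η : ℝ} (hη : 1 / 2 < η) (hη1 : η ≤ 1) (j : ℕ) :
    0 < supNorm (patternFn η j j) := by
  refine (supNorm_patternFn_nonneg η j j).lt_of_ne' fun h => ?_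
  have h1 := integral_kernelG_noisyLaw_eq_fockState hη hη1 j j j
  have h2 : ∀ x φ, kernelG η j j x φ = 0 := fun x φ =>
    norm_le_zero_iff.1 (h ▸ norm_kernelG_le η j j x φ)
  simp [h2, fockState] at h1

end QHT

end

/-! ### Union bound and conclusion -/

open QHT in
theorem theorem2 {Ω : Type*} [MeasurableSpace Ω] (P : Measure Ω) [IsProbabilityMeasure P]
    (η : ℝ) (hη : 1 / 2 < η) (hη1 : η ≤ 1)
    (ε : ℝ) (hε : 0 < ε) (hε1 : ε < 1)
    (B₀ : ℝ) (hB₀ : 0 < B₀)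
    (r₀ : ℝ) (hr₀ : 0 < r₀) (hr₀2 : r₀ < 2)
    (j₀ n : ℕ) (hN : max (2 * j₀) 2 < QHT.tuningN B₀ r₀ n)
    (Y Φ : Fin n → Ω → ℝ)
    (hindep : iIndepFun (fun l ω => (Y l ω, Φ l ω)) P)
    (hlaw : ∀ l, HasLaw (fun ω => (Y l ω, Φ l ω)) (QHT.noisyLaw η (QHT.fockState j₀)) P) :
    ENNReal.ofReal (1 - ε) ≤
      P {ω | QHT.l2Norm (fun j k =>
            QHT.rhoTilde η (QHT.tuningN B₀ r₀ n) ε (fun l => Y l ω) (fun l => Φ l ω) j k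
              - QHT.fockState j₀ j k) ^ 2
          < 64 / ((n : ℝ) * r₀) * QHT.supNorm (QHT.patternFn η j₀ j₀) ^ 2
              * Real.log (2 * Real.log n / (B₀ * ε))} := by
  obtain ⟨hN0, hN2⟩ := max_lt_iff.1 hN
  have hn := ne_zero_of_lt_tuningN hr₀ hN2
  have hn' : (0 : ℝ) < n := by exact_mod_cast Nat.pos_of_ne_zero hn
  have hlog := log_le_of_lt_tuningN hB₀ hr₀ hr₀2 hε hε1 hN2
  set N := tuningN B₀ r₀ n
  have hNpos : (2 : ℝ) < N := by exact_mod_cast hN2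
  set L := Real.log (2 * (N : ℝ) * ((N : ℝ) + 1) / ε) with hLdef
  have hL : 0 ≤ L := by
    refine Real.log_nonneg ?_
    rw [one_le_div hε]
    nlinarith
  have hexp : Real.exp (-L) = ε / (2 * N * (N + 1)) := by
    rw [Real.exp_neg, hLdef, Real.exp_log (by positivity), inv_div]
  let bad : ℕ × ℕ → Set Ω := fun p => {ω | threshold n η N ε p.1 p.2 <
    ‖rhoHat η N (fun l => Y l ω) (fun l => Φ l ω) p.1 p.2 - fockState j₀ p.1 p.2‖}
  have hbad : ∀ p : ℕ × ℕ, p.1 + p.2 < N → P.real (bad p) ≤ 4 * Real.exp (-L) := by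
    rintro ⟨j, k⟩ hp
    have hcont : Continuous fun z : ℝ × ℝ => kernelG η j k (z.1 / √η) z.2 :=
      continuous_kernelG_div hη j k
    have h := measureReal_norm_mean_sub_gt_le hn hindep (fun l => (hlaw l).aemeasurable)
      (g := fun z => kernelG η j k (z.1 / √η) z.2) hcont.measurable
      (fun z => norm_kernelG_le η j k _ _) (m := fockState j₀ j k)
      (fun l => by
        rw [← integral_kernelG_noisyLaw_eq_fockState hη hη1]
        exact (hlaw l).integral_comp hcont.aestronglyMeasurable) hL
    simp only [bad, rhoHat, if_pos hp, threshold]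
    exact h
  -- The antidiagonal `j + k = s` has `s + 1` entries, `N(N+1)/2` in all, each failing with
  -- probability at most `4e^{-L} = 2ε/(N(N+1))`.
  let Bad : Set Ω := ⋃ s ∈ Finset.range N, ⋃ p ∈ Finset.HasAntidiagonal.antidiagonal s, bad p
  have hBad : P.real Bad ≤ ε := by
    calc P.real Bad ≤ ∑ s ∈ Finset.range N, P.real (⋃ p ∈ Finset.HasAntidiagonal.antidiagonal s, bad p) :=
          measureReal_biUnion_finset_le _ _
      _ ≤ ∑ s ∈ Finset.range N, ∑ p ∈ Finset.HasAntidiagonal.antidiagonal s, P.real (bad p) :=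
          Finset.sum_le_sum fun s _ => measureReal_biUnion_finset_le _ _
      _ ≤ ∑ s ∈ Finset.range N, ∑ _p ∈ Finset.HasAntidiagonal.antidiagonal s, 4 * Real.exp (-L) := by
          refine Finset.sum_le_sum fun s hs => Finset.sum_le_sum fun p hp => hbad p ?_
          rw [Finset.HasAntidiagonal.mem_antidiagonal.1 hp]
          exact Finset.mem_range.1 hs
      _ = (∑ s ∈ Finset.range N, ((s : ℝ) + 1)) * (4 * Real.exp (-L)) := by
          simp [Finset.sum_mul]
      _ = N * (N + 1) / 2 * (4 * Real.exp (-L)) := by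
          congr 1
          clear_value N
          clear * -
          induction N with
          | zero => simp
          | succ N ih => rw [Finset.sum_range_succ, ih]; push_cast; ring
      _ = ε := by
          rw [hexp]
          field_simp
          ring
  set T := {ω | l2Norm (fun j k =>
            rhoTilde η N ε (fun l => Y l ω) (fun l => Φ l ω) j k - fockState j₀ j k) ^ 2
          < 64 / ((n : ℝ) * r₀) * supNorm (patternFn η j₀ j₀) ^ 2
              * Real.log (2 * Real.log n / (B₀ * ε))}
  have hT : Tᶜ ⊆ Bad := by
    intro ω hω
    by_contra hgood
    simp only [Bad, bad, Set.mem_iUnion, Finset.mem_range, Finset.HasAntidiagonal.mem_antidiagonal,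
      Set.mem_ofPred_eq, not_exists, not_lt] at hgood
    refine hω ((l2Norm_rhoTilde_sub_fockState_sq_le hN0 fun j k hjk =>
      hgood (j + k) hjk (j, k) rfl).trans_lt ?_)
    have hF := supNorm_patternFn_self_pos hη hη1 j₀
    have hsq : √(L / n) ^ 2 = L / n := Real.sq_sqrt (by positivity)
    rw [threshold, mul_pow, mul_pow, mul_pow, hsq]
    calc 2 ^ 2 * (2 ^ 2 * supNorm (patternFn η j₀ j₀) ^ 2 * (L / n))
        = 16 / n * supNorm (patternFn η j₀ j₀) ^ 2 * L := by ring
      _ < 16 / n * supNorm (patternFn η j₀ j₀) ^ 2 *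
          (4 / r₀ * Real.log (2 * Real.log n / (B₀ * ε))) :=
          mul_lt_mul_of_pos_left hlog (by positivity)
      _ = _ := by field_simp; ring
  rw [ENNReal.ofReal_sub _ hε.le, ENNReal.ofReal_one, tsub_le_iff_right]
  -- Subadditivity avoids any measurability claim about `T`.
  calc (1 : ENNReal) = P (T ∪ Tᶜ) := by rw [Set.union_compl_self, measure_univ]
    _ ≤ P T + P Tᶜ := measure_union_le _ _
    _ ≤ P T + ENNReal.ofReal ε := by
        gcongr
        refine (measure_mono hT).trans ?_
        rw [← ofReal_measureReal (measure_ne_top P Bad)]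
        exact ENNReal.ofReal_le_ofReal hBad
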